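/- **The Herlihy–Wing queue (HWQ).** The shared state is a counter $\mathit{back}$ (initially $0$) and an array $\mathit{items}$ indexed by $\mathbb N$ (all slots initially $\mathsf{null}$). A call $\mathsf{enq}(v)$ atomically executes $i:=\mathit{back}{+}{+}$ (step $\mathsf{enqI}$), then $\mathit{items}[i]:=v$ (step $\mathsf{enqW}$), then returns. A call $\mathsf{deq}()$ repeats the following loop: atomically choose any $\mathit{range}$ with $0\le \mathit{range}<\mathit{back}$ and set $j:=0$; while $j<\mathit{range}$, atomically swap $\mathit{items}[j]$ with $\mathsf{null}$, return the value found if it is not $\mathsf{null}$, and otherwise increment $j$. An iteration of the outer loop that returns is denoted $\mathsf{deqT}$, one that restarts $\mathsf{deqF}$. (Everything below holds as well when the inner guard is $j\le \mathit{range}$.) Values are taken from an arbitrary set, thread ids from an infinite totally ordered set; every thread performs at most one call. A *trace* is the sequence of thread-indexed steps of an execution, under arbitrary interleaving of finitely many calls, in which every started call has returned. A trace is *linearizable* if each of its threads can be assigned a position of the trace, not before the first step and before the return of its call, such that the operations, in the order of these positions (threads at the same position being ordered in some way), form a history of a sequential FIFO queue that is initially empty, in which a dequeue is only possible when the queue is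 non-empty. Let $E$ be the set of sequences of steps denoted by $$\left(\mathsf{deqF}^*\cdot \mathsf{enqI}^{+}\cdot \mathsf{enqW}^*\cdot \mathsf{deqT}^*\right)^*,$$ where $\mathsf{deqF}$ and $\mathsf{deqT}$ stand for entire iterations executed without interruption, $\mathsf{enqW}$ includes the return of its call, and inside a block the repetitions of $\mathsf{deqF},\mathsf{enqI},\mathsf{deqT}$ are ordered by increasing thread id and those of $\mathsf{enqW}$ by increasing slot. The *traces of the quotient expression* are the traces of the HWQ that belong to $E$ and in which the writes preceding a successful dequeue are ordered by slot, in the following sense: whenever an $\mathsf{enqW}$ on slot $i$ comes before an $\mathsf{enqW}$ on a slot $i'<i$ and both come before a swap that finds a value, the value in slot $i$ has been removed before that swap. **Theorem.** 1. The HWQ is linearizable: all its traces are linearizable. 2. Every trace of the quotient expression is linearizable with fixed linearization points: the linearization point of an enqueue is its $\mathsf{enqW}$ step, and that of a dequeue is its $\mathsf{deqT}$ step (the swap in it that finds a value). 3. For arbitrary traces, linearization points depend on the future: if there are three distinct values, there are traces $\pi\sigma_1$ and $\pi\sigma_2$ with a common prefix $\pi$, and two enqueues by threads $t_1,t_2$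 that have both returned within $\pi$, such that $t_1$ precedes $t_2$ in every linearization of $\pi\sigma_1$, while $t_2$ precedes $t_1$ in every linearization of $\pi\sigma_2$. -/

import Mathlib

namespace HerlihyWing

/-! ## The queue as a concurrent object -/

/-- The two readings of the guard of the scanning loop of a dequeue: `while (j < range)` and
`while (j <= range)`. -/
inductive LoopGuard
  | lt
  | le

/-- The guard of the scanning loop holds at index `j` with bound `range = r`. -/
def LoopGuard.Holds : LoopGuard → ℕ → ℕ → Prop
  | .lt, j, r => j < r
  | .le, j, r => j ≤ r

/-- Method calls with their arguments. -/
inductive Call (V : Type*)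
  | enq (v : V)
  | deq

/-- Labels of the atomic steps.  They record the values that are read and written, so a trace
determines the execution it comes from. Tests and assignments that touch only local variables are
merged into the neighbouring step. -/
inductive Label (V : Type*)
  /-- `i := back++` in a call `enq(v)`; the value read is `i`. -/
  | enqI (v : V) (i : ℕ)
  /-- `items[i] = v` -/
  | enqW (i : ℕ) (v : V)
  /-- return of an enqueue -/
  | enqRet
  /-- `assume 0 <= range < back; j = 0`, with `range = r` chosen -/
  | deqRead (r : ℕ)
  /-- `v := swap(items[j], null)`, with the value found (`none` is `null`); if it is `null`, the
  step includes `j++` -/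
  | deqSwap (j : ℕ) (found : Option V)
  /-- the scan ended without a value, back to the head of the outer loop -/
  | deqRestart
  /-- `return v` of a dequeue -/
  | deqRet (v : V)

def Label.IsReturn {V : Type*} : Label V → Prop
  | .enqRet => True
  | .deqRet _ => True
  | _ => False

/-- Local state of a thread together with its program point. -/
inductive LocalState (V : Type*)
  | enqStart (v : V)
  | enqReserved (v : V) (i : ℕ)
  | enqWritten
  | deqHead
  | deqScan (range j : ℕ)
  | deqFound (v : V)
  /-- the method has returned -/
  | finished

/-- The shared state: the counter `back` and the array `items` (`none` is `null`). -/
structure Shared (V : Type*) where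
  back : ℕ
  items : ℕ → Option V

def Shared.init (V : Type*) : Shared V := ⟨0, fun _ => none⟩

/-- The program point at which a call starts. -/
def Call.entry {V : Type*} : Call V → LocalState V
  | .enq v => .enqStart v
  | .deq => .deqHead

/-- One step of a single thread. -/
inductive ThreadStep {V : Type*} (g : LoopGuard) :
    LocalState V → Shared V → Label V → LocalState V → Shared V → Prop
  | enqI (v : V) (s : Shared V) :
      ThreadStep g (.enqStart v) s (.enqI v s.back)
        (.enqReserved v s.back) { s with back := s.back + 1 }
  | enqW (v : V) (i : ℕ) (s : Shared V) :
      ThreadStep g (.enqReserved v i) s (.enqW i v)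
        .enqWritten { s with items := Function.update s.items i (some v) }
  | enqRet (s : Shared V) : ThreadStep g .enqWritten s .enqRet .finished s
  | deqRead (r : ℕ) (s : Shared V) (hr : r < s.back) :
      ThreadStep g .deqHead s (.deqRead r) (.deqScan r 0) s
  | deqSwapNull (r j : ℕ) (s : Shared V) (hj : g.Holds j r) (h : s.items j = none) :
      ThreadStep g (.deqScan r j) s (.deqSwap j none) (.deqScan r (j + 1))
        { s with items := Function.update s.items j none }
  | deqSwapVal (r j : ℕ) (v : V) (s : Shared V) (hj : g.Holds j r) (h : s.items j = some v) :
      ThreadStep g (.deqScan r j) s (.deqSwap j (some v)) (.deqFound v)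
        { s with items := Function.update s.items j none }
  | deqRestart (r j : ℕ) (s : Shared V) (hj : ¬ g.Holds j r) :
      ThreadStep g (.deqScan r j) s .deqRestart .deqHead s
  | deqRet (v : V) (s : Shared V) : ThreadStep g (.deqFound v) s (.deqRet v) .finished s

/-- An environment: which threads call which method (`none`: the thread calls nothing).  Every
thread performs at most one call. -/
abbrev Env (T V : Type*) := T → Option (Call V)

/-- Shared state and local state of every thread that has started. -/
structure Config (T V : Type*) where
  shared : Shared V
  loc : T → Option (LocalState V)

def Config.init (T V : Type*) : Config T V := ⟨Shared.init V, fun _ => none⟩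

/-- Local state from which thread `t` takes its next step.  There is no separate invocation step:
the first instruction of a call plays this role. -/
def Config.current {T V : Type*} (env : Env T V) (c : Config T V) (t : T) :
    Option (LocalState V) :=
  (c.loc t).or ((env t).map Call.entry)

/-- A trace is a sequence of labels indexed by threads. -/
abbrev Trace (T V : Type*) := List (T × Label V)

/-- Executions of the queue in an environment: interleavings of steps of the threads. -/
inductive Exec {T V : Type*} [DecidableEq T] (g : LoopGuard) (env : Env T V) :
    Config T V → Trace T V → Config T V → Prop
  | nil (c : Config T V) : Exec g env c [] c
  | cons {c c' : Config T V} {t : T} {a : Label V} {l l' : LocalState V} {s' : Shared V}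
      {τ : Trace T V} (hl : c.current env t = some l) (hs : ThreadStep g l c.shared a l' s')
      (h : Exec g env ⟨s', Function.update c.loc t (some l')⟩ τ c') :
      Exec g env c ((t, a) :: τ) c'

/-- Every thread that has started has returned. -/
def Config.Final {T V : Type*} (c : Config T V) : Prop :=
  ∀ t l, c.loc t = some l → l = .finished

/-- The semantics of the queue: traces of completed executions in finite environments. -/
def traces (T V : Type*) [DecidableEq T] (g : LoopGuard) : Set (Trace T V) :=
  {τ | ∃ env : Env T V, {t | env t ≠ none}.Finite ∧
    ∃ c : Config T V, Exec g env (Config.init T V) τ c ∧ c.Final}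

/-! ## Linearizability -/

/-- Operation symbols `enq(v)/()` and `deq()/v`. -/
inductive Op (V : Type*)
  | enq (v : V)
  | deq (v : V)

/-- `QueueRun q h`: the operations `h` can be executed one after another on a FIFO queue with
contents `q`. -/
def QueueRun {V : Type*} : List V → List (Op V) → Prop
  | _, [] => True
  | q, .enq v :: h => QueueRun (q ++ [v]) h
  | q, .deq v :: h => ∃ q', q = v :: q' ∧ QueueRun q' h

/-- The sequential specification: histories of a FIFO queue that is initially empty. -/
def queueSpec (V : Type*) : Set (List (Op V)) := {h | QueueRun [] h}

/-- `OpOf τ t o`: in the trace `τ` the thread `t` performs the operation `o`. -/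
def OpOf {T V : Type*} (τ : Trace T V) (t : T) : Op V → Prop
  | .enq v => ∃ i, (t, Label.enqI v i) ∈ τ
  | .deq v => (t, Label.deqRet v) ∈ τ

/-- The mapping `lp` of threads to positions of `τ`, with `L` the threads of `τ` in the order of
these positions, is a linearization of `τ` with respect to the FIFO queue: every position is not
before the first step and before the return of its thread, and the resulting sequence of operations
belongs to the specification.  Several threads may be linearized at one position; `L` then fixes
their order. -/
structure IsLinearization {T V : Type*} (τ : Trace T V) (lp : T → ℕ) (L : List T) : Prop where
  nodup : L.Nodup
  mem_iff : ∀ t, t ∈ L ↔ ∃ a, (t, a) ∈ τ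
  sorted : L.Pairwise (fun t u => lp t ≤ lp u)
  after_start : ∀ t ∈ L, ∃ k a, k ≤ lp t ∧ τ[k]? = some (t, a)
  before_return : ∀ t ∈ L, ∃ k a, lp t < k ∧ τ[k]? = some (t, a) ∧ a.IsReturn
  legal : ∃ ops : List (Op V), List.Forall₂ (OpOf τ) L ops ∧ ops ∈ queueSpec V

def Linearizable {T V : Type*} (τ : Trace T V) : Prop :=
  ∃ (lp : T → ℕ) (L : List T), IsLinearization τ lp L

/-- `lp` sends every thread of `τ` to the step at which it writes its slot (enqueue) or at which
its swap finds a value (the effect of its successful iteration, for a dequeue). -/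
def IsFixedPoints {T V : Type*} (τ : Trace T V) (lp : T → ℕ) : Prop :=
  ∀ t, (∃ a, (t, a) ∈ τ) →
    (∃ i v, τ[lp t]? = some (t, Label.enqW i v)) ∨
    (∃ j v, τ[lp t]? = some (t, Label.deqSwap j (some v)))

/-! ## The quotient expression -/

/-- Finite concatenations of words taken from members `W k` of a family of languages, at strictly
increasing indices `k`. -/
def orderedStar {ι α : Type*} [LT ι] (W : ι → Language α) : Language α :=
  {w | ∃ l : List (ι × List α), l.Pairwise (fun x y => x.1 < y.1) ∧
    (∀ x ∈ l, x.2 ∈ W x.1) ∧ w = (l.map Prod.snd).flatten}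

/-- The same, with at least one word. -/
def orderedPlus {ι α : Type*} [LT ι] (W : ι → Language α) : Language α :=
  {w | ∃ l : List (ι × List α), l ≠ [] ∧ l.Pairwise (fun x y => x.1 < y.1) ∧
    (∀ x ∈ l, x.2 ∈ W x.1) ∧ w = (l.map Prod.snd).flatten}

/-- `enqI` by thread `t`. -/
def enqI {T V : Type*} (t : T) : Language (T × Label V) :=
  {w | ∃ v i, w = [(t, .enqI v i)]}

/-- `enqW` on slot `i`, by any thread, with the return that ends the call. -/
def enqW {T V : Type*} (i : ℕ) : Language (T × Label V) :=
  {w | ∃ t v, w = [(t, .enqW i v), (t, .enqRet)]}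

/-- The first `k` swaps of an iteration, all of which find `null`. -/
def nullSwaps {T V : Type*} (t : T) (k : ℕ) : Trace T V :=
  (List.range k).map fun j => (t, .deqSwap j none)

/-- `deqF`: an entire iteration of the outer loop of a dequeue by `t` that restarts. -/
def deqF {T V : Type*} (t : T) : Language (T × Label V) :=
  {w | ∃ r k, w = (t, .deqRead r) :: nullSwaps t k ++ [(t, .deqRestart)]}

/-- `deqT`: an entire iteration of the outer loop of a dequeue by `t` that returns. -/
def deqT {T V : Type*} (t : T) : Language (T × Label V) :=
  {w | ∃ r k v, w = (t, .deqRead r) :: nullSwaps t k ++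
    [(t, .deqSwap k (some v)), (t, .deqRet v)]}

open scoped Computability in
/-- The interpretation of `(deqF* · enqI⁺ · enqW* · deqT*)*`.  Inside one block the repetitions are
ordered by thread, those of `enqW` by the slot that is written. -/
def quotientExpr (T V : Type*) [LinearOrder T] : Language (T × Label V) :=
  (orderedStar deqF * orderedPlus enqI * orderedStar enqW * orderedStar deqT)∗

/-- The writes that precede a successful dequeue are ordered by slot: if `enqW` on slot `i` comes
before `enqW` on a smaller slot, and both come before a swap that finds a value, then the value in
slot `i` has been removed before this swap.  (So, at every successful dequeue, the values present
in the array were written in the order of their slots.) -/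
def WritesOrdered {T V : Type*} (τ : Trace T V) : Prop :=
  ∀ (p q r : ℕ) (t t' u : T) (i i' j : ℕ) (v v' x : V), p < q → q < r → i' < i →
    τ[p]? = some (t, Label.enqW i v) → τ[q]? = some (t', Label.enqW i' v') →
    τ[r]? = some (u, Label.deqSwap j (some x)) →
    ∃ m w y, p < m ∧ m < r ∧ τ[m]? = some (w, Label.deqSwap i (some y))

/-- In the list `L`, `t` occurs before `u`. -/
def Precedes {T : Type*} (L : List T) (t u : T) : Prop :=
  ∃ (k m : ℕ), k < m ∧ L[k]? = some t ∧ L[m]? = some u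

end HerlihyWing

namespace HerlihyWing

variable {T V : Type*}

/-! Slots are reserved in increasing order, each is written at most once and emptied at most once,
and a dequeue that empties slot `j` has read its range after `j` was reserved and has then found
null in every smaller slot. An invariant of executions (`HistInv`) yields these facts, collected in
`TraceFacts`; both positive results use the queue only through them.

By `TraceFacts.legal`, an order of the threads is legal as soon as every value is enqueued before it
is removed, and whatever is enqueued before a removed value is itself removed earlier. Slots stand
for values here, since values may repeat.

For arbitrary traces the enqueues are ranked in hindsight by the time at which their values are
removed; values that stay come last, by slot. This ranking respects real time: if one enqueue
returns before another starts, it has the smaller slot, and whoever removes the later value has seen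
the smaller slot null after it was written, so that slot had been emptied before. A dequeue is
linearized at its successful swap, an enqueue at the latest start among the enqueues of no larger
rank, ties being broken by rank.

For the quotient expression the writes serve as linearization points. If slot `i'` is written before
slot `i` and `i` is emptied, then `i'` is emptied earlier: for `i < i'` this is `WritesOrdered`; for
`i' < i` the scan is uninterrupted, so it passes `i'` after the write to `i'` and finds null there.

For the dependence on the future, a dequeue passes slot 0 before `a` is written there, while `b`
goes to slot 1. If that dequeue resumes at once it removes `b` and `a` is never removed; if others
intervene they remove `a` and then `b`. FIFO order forces opposite orders of the two enqueues. -/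

/-! ## Invariants of executions -/

/-- Labels of a dequeue that has not found a value yet. -/
def Label.IsSearch : Label V → Prop
  | .deqRead _ => True
  | .deqSwap _ none => True
  | .deqRestart => True
  | _ => False

/-- `t` performs a complete call `enq(v)` on slot `i`, and its steps are at `p`, `q` and `r`. -/
structure IsEnq (τ : Trace T V) (t : T) (v : V) (i p q r : ℕ) : Prop where
  lt_write : p < q
  lt_ret : q < r
  reserve : τ[p]? = some (t, .enqI v i)
  write : τ[q]? = some (t, .enqW i v)
  ret : τ[r]? = some (t, .enqRet)
  steps : ∀ (k : ℕ) (a : Label V), τ[k]? = some (t, a) → k = p ∨ k = q ∨ k = r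

/-- `t` performs a complete dequeue that finds `v` in slot `j` at position `q` and returns at `r`. -/
structure IsDeq (τ : Trace T V) (t : T) (v : V) (j q r : ℕ) : Prop where
  lt_ret : q < r
  swap : τ[q]? = some (t, .deqSwap j (some v))
  ret : τ[r]? = some (t, .deqRet v)
  steps : ∀ (k : ℕ) (a : Label V), τ[k]? = some (t, a) → k = q ∨ k = r ∨ a.IsSearch

/-- What the local state of `t` tells about the steps that `t` has performed. -/
def LocalState.Hist (h : Trace T V) (t : T) : LocalState V → Prop
  | .enqStart _ => ∀ (k : ℕ) (a : Label V), h[k]? ≠ some (t, a)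
  | .enqReserved v i => ∃ (p : ℕ), h[p]? = some (t, .enqI v i) ∧ ∀ (k : ℕ) (a : Label V), h[k]? = some (t, a) → k = p
  | .enqWritten => ∃ (v : V) (i p q : ℕ), p < q ∧ h[p]? = some (t, .enqI v i) ∧
      h[q]? = some (t, .enqW i v) ∧ ∀ (k : ℕ) (a : Label V), h[k]? = some (t, a) → k = p ∨ k = q
  | .deqHead => ∀ (k : ℕ) (a : Label V), h[k]? = some (t, a) → a.IsSearch
  | .deqScan r j => (∀ (k : ℕ) (a : Label V), h[k]? = some (t, a) → a.IsSearch) ∧ ∃ (p : ℕ),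
      (∀ i ≤ r, ∃ (q : ℕ) (u : T) (v : V), q < p ∧ h[q]? = some (u, .enqI v i)) ∧
      ∀ i < j, ∃ (q : ℕ), p ≤ q ∧ h[q]? = some (t, .deqSwap i none)
  | .deqFound v => ∃ (j q : ℕ), h[q]? = some (t, .deqSwap j (some v)) ∧
      ∀ (k : ℕ) (a : Label V), h[k]? = some (t, a) → k = q ∨ a.IsSearch
  | .finished => (∃ (v : V) (i p q r : ℕ), IsEnq h t v i p q r) ∨ ∃ (v : V) (j q r : ℕ), IsDeq h t v j q r

theorem getElem?_concat_iff {α : Type*} (h : List α) (x y : α) (k : ℕ) :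
    (h ++ [x])[k]? = some y ↔ h[k]? = some y ∨ (k = h.length ∧ x = y) := by
  rcases lt_trichotomy k h.length with hk | hk | hk
  · rw [List.getElem?_append_left hk]; simp [hk.ne]
  · subst hk; simp
  · rw [List.getElem?_eq_none (by simp; omega), List.getElem?_eq_none (by omega)]
    simp [hk.ne']

theorem lt_length_of_getElem? {α : Type*} {h : List α} {x : α} {k : ℕ} (hk : h[k]? = some x) :
    k < h.length := by
  by_contra hc
  rw [List.getElem?_eq_none (by omega)] at hk
  cases hk

/-- What the history says exhaustively concerns only steps of `t`; about other threads it only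
asserts that certain steps exist, which persists when the trace grows. -/
theorem LocalState.Hist.concat {h : Trace T V} {t u : T} {a : Label V} {l : LocalState V}
    (hl : l.Hist h t) (hu : u ≠ t) : l.Hist (h ++ [(u, a)]) t := by
  have key : ∀ (k : ℕ) (b : Label V), (h ++ [(u, a)])[k]? = some (t, b) ↔ h[k]? = some (t, b) := by
    intro k b
    rw [getElem?_concat_iff]
    simp [hu]
  have mono : ∀ {k x}, h[k]? = some x → (h ++ [(u, a)])[k]? = some x :=
    fun hx => (getElem?_concat_iff _ _ _ _).2 (.inl hx)
  cases l with
  | deqScan r j =>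
    obtain ⟨h1, p, h2, h3⟩ := hl
    refine ⟨fun k b => by rw [key]; exact h1 k b, p, fun i hi => ?_, fun i hi => ?_⟩
    · obtain ⟨q, w, v, hq, hw⟩ := h2 i hi
      exact ⟨q, w, v, hq, mono hw⟩
    · obtain ⟨q, hq, hw⟩ := h3 i hi
      exact ⟨q, hq, mono hw⟩
  | finished =>
    rcases hl with ⟨v, i, p, q, r, ⟨⟩⟩ | ⟨v, j, q, r, ⟨⟩⟩
    · exact .inl ⟨v, i, p, q, r, by constructor <;> (try simp only [key]) <;> assumption⟩
    · exact .inr ⟨v, j, q, r, by constructor <;> (try simp only [key]) <;> assumption⟩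
  | _ => simpa only [Hist, key, ne_eq] using hl

/-- The invariant that relates the steps `h` performed so far to the configuration. -/
structure HistInv (env : Env T V) (h : Trace T V) (c : Config T V) : Prop where
  none_steps : ∀ t, c.loc t = none → ∀ (k : ℕ) (a : Label V), h[k]? ≠ some (t, a)
  loc_hist : ∀ t l, c.loc t = some l → l.Hist h t
  enqI_lt : ∀ (p : ℕ) (t : T) (v : V) (i : ℕ), h[p]? = some (t, .enqI v i) → i < c.shared.back
  enqI_exists : ∀ i < c.shared.back, ∃ (p : ℕ) (t : T) (v : V), h[p]? = some (t, .enqI v i)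
  enqI_mono : ∀ (p p' : ℕ) (t t' : T) (v v' : V) (i i' : ℕ), h[p]? = some (t, .enqI v i) →
    h[p']? = some (t', .enqI v' i') → p < p' → i < i'
  items_some : ∀ (i : ℕ) (v : V), c.shared.items i = some v → ∃ (q : ℕ) (t : T), h[q]? = some (t, .enqW i v) ∧
    ∀ (k : ℕ) (u : T) (x : V), q < k → h[k]? ≠ some (u, .deqSwap i (some x))
  items_none : ∀ (i : ℕ), c.shared.items i = none → ∀ (q : ℕ) (t : T) (v : V), h[q]? = some (t, .enqW i v) →
    ∃ (k : ℕ) (u : T) (x : V), q < k ∧ h[k]? = some (u, .deqSwap i (some x))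
  swap_some : ∀ (q : ℕ) (t : T) (j : ℕ) (v : V), h[q]? = some (t, .deqSwap j (some v)) →
    ∃ (q' : ℕ) (t' : T), q' < q ∧ h[q']? = some (t', .enqW j v) ∧
    ∀ (k : ℕ) (u : T) (x : V), q' < k → k < q → h[k]? ≠ some (u, .deqSwap j (some x))
  swap_none : ∀ (q : ℕ) (t : T) (j : ℕ), h[q]? = some (t, .deqSwap j none) →
    ∀ (q' : ℕ) (t' : T) (v : V), q' < q → h[q']? = some (t', .enqW j v) →
    ∃ (k : ℕ) (u : T) (x : V), q' < k ∧ k < q ∧ h[k]? = some (u, .deqSwap j (some x))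
  scan : ∀ (q : ℕ) (t : T) (j : ℕ) (v : V), h[q]? = some (t, .deqSwap j (some v)) →
    ∃ (p : ℕ), (∃ (k : ℕ) (u : T) (w : V), k < p ∧ h[k]? = some (u, .enqI w j)) ∧
    ∀ i < j, ∃ (k : ℕ), p ≤ k ∧ k < q ∧ h[k]? = some (t, .deqSwap i none)

theorem HistInv.init (env : Env T V) : HistInv env [] (Config.init T V) := by
  constructor <;> simp [Config.init, Shared.init]

theorem HistInv.current_hist {env : Env T V} {h : Trace T V} {c : Config T V}
    (H : HistInv env h c) {t : T} {l : LocalState V} (hl : c.current env t = some l) :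
    l.Hist h t := by
  unfold Config.current at hl
  cases hc : c.loc t with
  | some l' =>
    rw [hc] at hl
    simp only [Option.some_or, Option.some.injEq] at hl
    exact hl ▸ H.loc_hist t l' hc
  | none =>
    have hn := H.none_steps t hc
    rw [hc] at hl
    simp only [Option.none_or, Option.map_eq_some_iff] at hl
    obtain ⟨m, -, rfl⟩ := hl
    cases m with
    | enq v => exact hn
    | deq => exact fun k a hk => absurd hk (hn k a)

/-- The global invariant enters only at the range read: all slots below `back` have been reserved by
then, hence all slots up to the chosen range. -/
theorem ThreadStep.hist {g : LoopGuard} {env : Env T V} {h : Trace T V} {c : Config T V}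
    (H : HistInv env h c) {t : T} {a : Label V} {l l' : LocalState V} {s' : Shared V}
    (hl : l.Hist h t) (hs : ThreadStep g l c.shared a l' s') : l'.Hist (h ++ [(t, a)]) t := by
  have hlen : ∀ (k : ℕ) (x : T × Label V), h[k]? = some x → k < h.length := fun _ _ => lt_length_of_getElem?
  have e := getElem?_concat_iff h (t, a)
  generalize hG : h ++ [(t, a)] = G at e ⊢
  cases hs with
  | enqI v =>
    simp only [LocalState.Hist] at hl ⊢
    exact ⟨h.length, by grind⟩
  | enqW v i =>
    obtain ⟨p, hp, hu⟩ := hl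
    refine ⟨v, i, p, h.length, ?_⟩
    grind
  | enqRet =>
    obtain ⟨v, i, p, q, hpq, hp, hq, hu⟩ := hl
    refine .inl ⟨v, i, p, q, h.length, ?_⟩
    constructor <;> grind
  | deqRead r _ hr =>
    refine ⟨?_, h.length, ?_, ?_⟩
    · simp only [LocalState.Hist] at hl
      grind [Label.IsSearch]
    · intro i hi
      obtain ⟨p, u, v, hp⟩ := H.enqI_exists i (by omega)
      exact ⟨p, u, v, hlen _ _ hp, (e _ _).2 (.inl hp)⟩
    · intro i hi; omega
  | deqSwapNull r j _ hj hn =>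
    obtain ⟨h1, p, h2, h3⟩ := hl
    -- The history does not bound `p` by the length of the trace; the minimum makes the new swap, at
    -- position `h.length`, lie at or after the start of the scan.
    refine ⟨by grind [Label.IsSearch], min p h.length, fun i hi => ?_, ?_⟩
    · obtain ⟨q, u, w, b1, b2⟩ := h2 i hi
      exact ⟨q, u, w, lt_min b1 (hlen _ _ b2), (e _ _).2 (.inl b2)⟩
    intro i hi
    by_cases hij : i = j
    · exact ⟨h.length, by omega, (e _ _).2 (.inr ⟨rfl, by rw [hij]⟩)⟩
    · obtain ⟨q, hq, hw⟩ := h3 i (by omega)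
      exact ⟨q, by omega, (e _ _).2 (.inl hw)⟩
  | deqSwapVal r j v _ hj hn =>
    obtain ⟨h1, -⟩ := hl
    refine ⟨j, h.length, ?_⟩
    grind
  | deqRestart r j =>
    obtain ⟨h1, -⟩ := hl
    simp only [LocalState.Hist]
    grind [Label.IsSearch]
  | deqRet v =>
    obtain ⟨j, q, h1, h2⟩ := hl
    refine .inr ⟨v, j, q, h.length, ?_⟩
    constructor <;> grind

theorem HistInv.step [DecidableEq T] {g : LoopGuard} {env : Env T V} {h : Trace T V}
    {c : Config T V} (H : HistInv env h c) {t : T} {a : Label V} {l l' : LocalState V}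
    {s' : Shared V} (hl : c.current env t = some l) (hs : ThreadStep g l c.shared a l' s') :
    HistInv env (h ++ [(t, a)]) ⟨s', Function.update c.loc t (some l')⟩ := by
  have hl := H.current_hist hl
  have hl' := hs.hist H hl
  have hlen : ∀ (k : ℕ) (x : T × Label V), h[k]? = some x → k < h.length := fun _ _ => lt_length_of_getElem?
  have e := getElem?_concat_iff h (t, a)
  have hloc : ∀ u m, Function.update c.loc t (some l') u = some m →
      m.Hist (h ++ [(t, a)]) u := by
    intro u m hm
    by_cases hu : u = t
    · subst hu
      simp only [Function.update_self, Option.some.injEq] at hm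
      exact hm ▸ hl'
    · rw [Function.update_of_ne hu] at hm
      exact (H.loc_hist u m hm).concat (Ne.symm hu)
  have hnone : ∀ u, Function.update c.loc t (some l') u = none → ∀ (k : ℕ) (b : Label V),
      (h ++ [(t, a)])[k]? ≠ some (u, b) := by
    intro u hm k b hk
    by_cases hu : u = t
    · subst hu; simp at hm
    · rw [Function.update_of_ne hu] at hm
      rw [e] at hk
      rcases hk with hk | ⟨-, hk⟩
      · exact H.none_steps u hm k b hk
      · exact hu (congrArg Prod.fst hk).symm
  obtain ⟨-, -, h1, h2, h3, h4, h5, h6, h7, h8⟩ := H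
  generalize hG : h ++ [(t, a)] = G at e hloc hnone ⊢
  -- A swap that finds a value is explained by the clause on occupied slots, one that finds null by
  -- the clause on empty slots, and the scan clause by the local history of the scanning thread.
  -- Each goal keeps only the old clauses it needs.
  refine ⟨hnone, hloc, ?_, ?_, ?_, ?_, ?_, ?_, ?_, ?_⟩ <;> clear hloc hnone hl' <;> try dsimp only
  · clear h2 h3 h4 h5 h6 h7 h8
    cases hs <;> grind
  · clear h1 h3 h4 h5 h6 h7 h8
    intro i hi
    cases hs with
    | enqI v =>
      by_cases hb : i = c.shared.back
      · exact ⟨h.length, t, v, by grind⟩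
      · obtain ⟨p, u, w, hp⟩ := h2 i (by grind)
        exact ⟨p, u, w, by grind⟩
    | _ =>
      obtain ⟨p, u, w, hp⟩ := h2 i hi
      exact ⟨p, u, w, by grind⟩
  · clear h2 h4 h5 h6 h7 h8
    cases hs <;> grind
  · clear h1 h2 h3 h6 h7 h8
    intro i v hi
    cases hs with
    | enqW w j _ =>
      by_cases hij : i = j
      · exact ⟨h.length, t, by grind⟩
      · obtain ⟨q, u, hq⟩ := h4 i v (by grind)
        exact ⟨q, u, by grind⟩
    | _ =>
      obtain ⟨q, u, hq⟩ := h4 i v (by grind)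
      exact ⟨q, u, by grind⟩
  · clear h1 h2 h3 h4 h6 h7 h8
    intro i hi q u v hq
    cases hs with
    | deqSwapVal r j w _ hj hn =>
      by_cases hij : i = j
      · exact ⟨h.length, t, w, by grind⟩
      · obtain ⟨k, u', x, hk⟩ := h5 i (by grind) q u v (by grind)
        exact ⟨k, u', x, by grind⟩
    | _ =>
      obtain ⟨k, u', x, hk⟩ := h5 i (by grind) q u v (by grind)
      exact ⟨k, u', x, by grind⟩
  · clear h1 h2 h3 h5 h7 h8
    intro q u j v hq
    rcases (e _ _).1 hq with hq' | ⟨rfl, hx⟩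
    · obtain ⟨q', t', a1, a2, a3⟩ := h6 q u j v hq'
      exact ⟨q', t', a1, by grind, by grind⟩
    · cases hx
      cases hs with
      | deqSwapVal r _ _ _ hj hn =>
        obtain ⟨q', t', a1, a2⟩ := h4 j v hn
        exact ⟨q', t', hlen _ _ a1, by grind, by grind⟩
  · clear h1 h2 h3 h4 h6 h8
    intro q u j hq q' t' v hlt hq'
    rcases (e _ _).1 hq with hq1 | ⟨rfl, hx⟩
    · obtain ⟨k, u', x, hk⟩ := h7 q u j hq1 q' t' v hlt (by grind)
      exact ⟨k, u', x, by grind⟩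
    · cases hx
      cases hs with
      | deqSwapNull r _ _ hj hn =>
        obtain ⟨k, u', x, hk⟩ := h5 j hn q' t' v (by grind)
        exact ⟨k, u', x, hk.1, hlen _ _ hk.2, by grind⟩
  · clear h1 h2 h3 h4 h5 h6 h7
    intro q u j v hq
    rcases (e _ _).1 hq with hq1 | ⟨rfl, hx⟩
    · obtain ⟨p, ⟨k, u', w, a1, a2⟩, a3⟩ := h8 q u j v hq1
      refine ⟨p, ⟨k, u', w, a1, by grind⟩, fun i hi => ?_⟩
      obtain ⟨k', b1, b2, b3⟩ := a3 i hi
      exact ⟨k', b1, b2, by grind⟩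
    · cases hx
      cases hs with
      | deqSwapVal r _ _ _ hj hn =>
        obtain ⟨-, p, a1, a2⟩ := hl
        -- Either reading of the guard gives this bound, which is all that is used of the guard.
        have hjr : j ≤ r := by
          cases g
          · exact le_of_lt hj
          · exact hj
        obtain ⟨k, u', w, b1, b2⟩ := a1 j hjr
        refine ⟨p, ⟨k, u', w, b1, by grind⟩, fun i hi => ?_⟩
        obtain ⟨k', d1, d2⟩ := a2 i hi
        exact ⟨k', d1, hlen _ _ d2, by grind⟩

theorem HistInv.exec [DecidableEq T] {g : LoopGuard} {env : Env T V} {c c' : Config T V}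
    {τ : Trace T V} (E : Exec g env c τ c') {h : Trace T V} (H : HistInv env h c) :
    HistInv env (h ++ τ) c' := by
  induction E generalizing h with
  | nil c => simpa using H
  | cons hl hs _ ih =>
    have := ih (H.step hl hs)
    simpa using this

/-! ### Facts about completed traces -/

/-- The facts about completed executions on which linearizability rests. -/
structure TraceFacts (τ : Trace T V) : Prop where
  complete : ∀ (k : ℕ) (t : T) (a : Label V), τ[k]? = some (t, a) →
    (∃ (v : V) (i p q r : ℕ), IsEnq τ t v i p q r) ∨ ∃ (v : V) (j q r : ℕ), IsDeq τ t v j q r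
  slot_mono : ∀ {t t' v v' i i' p p' q q' r r'}, IsEnq τ t v i p q r →
    IsEnq τ t' v' i' p' q' r' → p < p' → i < i'
  enq_of_deq : ∀ {d v j q r}, IsDeq τ d v j q r → ∃ (t : T) (p q' r' : ℕ), IsEnq τ t v j p q' r' ∧ q' < q
  deq_unique : ∀ {d d' v v' j q q' r r'}, IsDeq τ d v j q r → IsDeq τ d' v' j q' r' → d = d'
  swap_none : ∀ {u j k t v p q r}, τ[k]? = some (u, .deqSwap j none) → IsEnq τ t v j p q r →
    q < k → ∃ (d : T) (w : V) (q' r' : ℕ), IsDeq τ d w j q' r' ∧ q' < k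
  scan : ∀ {d v j q r t v' p q' r'}, IsDeq τ d v j q r → IsEnq τ t v' j p q' r' →
    ∀ i < j, ∃ (k : ℕ), p < k ∧ k < q ∧ τ[k]? = some (d, .deqSwap i none)

theorem traceFacts_of_mem_traces [DecidableEq T] {g : LoopGuard} {τ : Trace T V}
    (hτ : τ ∈ traces T V g) : TraceFacts τ := by
  obtain ⟨env, -, c, E, hF⟩ := hτ
  have H := (HistInv.init env).exec E
  rw [List.nil_append] at H
  have complete : ∀ (k : ℕ) (t : T) (a : Label V), τ[k]? = some (t, a) →
      (∃ (v : V) (i p q r : ℕ), IsEnq τ t v i p q r) ∨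
        ∃ (v : V) (j q r : ℕ), IsDeq τ t v j q r := by
    intro k t a hk
    cases hc : c.loc t with
    | none => exact absurd hk (H.none_steps t hc k a)
    | some l =>
      have hl := H.loc_hist t l hc
      rw [hF t l hc] at hl
      exact hl
  have enq_write : ∀ (t : T) (i q : ℕ) (v : V), τ[q]? = some (t, .enqW i v) →
      ∃ (p r : ℕ), IsEnq τ t v i p q r := by
    intro t i q v hq
    rcases complete _ _ _ hq with ⟨v', i', p', q', r', h⟩ | ⟨v', j', q', r', h⟩
    · have h1 := h.steps _ _ hq
      have h2 := h.reserve; have h3 := h.write; have h4 := h.ret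
      have : q = q' := by grind
      subst this
      have : i = i' ∧ v = v' := by grind
      obtain ⟨rfl, rfl⟩ := this
      exact ⟨p', r', h⟩
    · have h1 := h.steps _ _ hq
      have h2 := h.swap; have h4 := h.ret
      grind [Label.IsSearch]
  have deq_swap : ∀ (t : T) (i q : ℕ) (v : V), τ[q]? = some (t, .deqSwap i (some v)) →
      ∃ (r : ℕ), IsDeq τ t v i q r := by
    intro t i q v hq
    rcases complete _ _ _ hq with ⟨v', i', p', q', r', h⟩ | ⟨v', j', q', r', h⟩
    · have h1 := h.steps _ _ hq
      have h2 := h.reserve; have h3 := h.write; have h4 := h.ret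
      grind
    · have h1 := h.steps _ _ hq
      have h2 := h.swap; have h4 := h.ret
      have : q = q' := by grind [Label.IsSearch]
      subst this
      have : i = j' ∧ v = v' := by grind
      obtain ⟨rfl, rfl⟩ := this
      exact ⟨r', h⟩
  have reserve_unique : ∀ (t t' : T) (v v' : V) (i p p' : ℕ), τ[p]? = some (t, .enqI v i) →
      τ[p']? = some (t', .enqI v' i) → p = p' := by
    intro t t' v v' i p p' h h'
    rcases lt_trichotomy p p' with hp | hp | hp
    · exact absurd (H.enqI_mono _ _ _ _ _ _ _ _ h h' hp) (lt_irrefl _)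
    · exact hp
    · exact absurd (H.enqI_mono _ _ _ _ _ _ _ _ h' h hp) (lt_irrefl _)
  -- Writes to one slot come from calls that reserved it, and reservations are strictly increasing,
  -- so it is the same call.
  have write_unique : ∀ (t t' : T) (v v' : V) (i q q' : ℕ), τ[q]? = some (t, .enqW i v) →
      τ[q']? = some (t', .enqW i v') → q = q' := by
    intro t t' v v' i q q' h h'
    obtain ⟨p, r, hE⟩ := enq_write _ _ _ _ h
    obtain ⟨p', r', hE'⟩ := enq_write _ _ _ _ h'
    have h1 := hE.reserve; have h2 := hE'.reserve
    have hp := reserve_unique _ _ _ _ _ _ _ h1 h2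
    subst hp
    have : t = t' := by grind
    subst this
    have h3 := hE.steps _ _ h'
    have h4 := hE.ret
    grind
  refine ⟨complete, ?_, ?_, ?_, ?_, ?_⟩
  · intro t t' v v' i i' p p' q q' r r' h h' hp
    exact H.enqI_mono _ _ _ _ _ _ _ _ h.reserve h'.reserve hp
  · intro d v j q r h
    obtain ⟨q', t', hlt, hq', -⟩ := H.swap_some _ _ _ _ h.swap
    obtain ⟨p, r', hE⟩ := enq_write _ _ _ _ hq'
    exact ⟨t', p, q', r', hE, hlt⟩
  · intro d d' v v' j q q' r r' h h'
    obtain ⟨w, t, a1, a2, a3⟩ := H.swap_some _ _ _ _ h.swap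
    obtain ⟨w', t', b1, b2, b3⟩ := H.swap_some _ _ _ _ h'.swap
    -- Both removals go back to the same write, with no removal of this slot in between; hence
    -- neither can come before the other.
    obtain rfl := write_unique _ _ _ _ _ _ _ a2 b2
    have h1 := h.swap; have h2 := h'.swap
    rcases lt_trichotomy q q' with hq | hq | hq
    · exact absurd h1 (b3 _ _ _ a1 hq)
    · subst hq; grind
    · exact absurd h2 (a3 _ _ _ b1 hq)
  · intro u j k t v p q r hk hE hq
    obtain ⟨m, d, x, h1, h2, h3⟩ := H.swap_none _ _ _ hk _ _ _ hq hE.write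
    obtain ⟨r', hD⟩ := deq_swap _ _ _ _ h3
    exact ⟨d, x, m, r', hD, h2⟩
  · intro d v j q r t v' p q' r' hD hE i hi
    obtain ⟨m, ⟨k, u, w, h1, h2⟩, h3⟩ := H.scan _ _ _ _ hD.swap
    obtain rfl := reserve_unique _ _ _ _ _ _ _ h2 hE.reserve
    obtain ⟨k', a1, a2, a3⟩ := h3 i hi
    exact ⟨k', by omega, a2, a3⟩

/-! ## Histories of a FIFO queue -/

/-- The value that an operation enqueues. -/
def Op.enqVal : Op V → Option V
  | .enq v => some v
  | .deq _ => none

/-- The value that an operation dequeues. -/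
def Op.deqVal : Op V → Option V
  | .enq _ => none
  | .deq v => some v

/-- A history can be executed iff at every moment the dequeued values are a prefix of the initial
contents followed by the enqueued values. -/
theorem queueRun_iff_prefix (q : List V) (h : List (Op V)) :
    QueueRun q h ↔
      ∀ P, P <+: h → P.filterMap Op.deqVal <+: q ++ P.filterMap Op.enqVal := by
  induction h generalizing q with
  | nil => simp [QueueRun]
  | cons o h ih =>
    cases o with
    | enq v =>
      rw [QueueRun, ih]
      constructor
      · intro H P hP
        rcases List.prefix_cons_iff.1 hP with rfl | ⟨P', rfl, hP'⟩
        · simp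
        · simpa [List.filterMap_cons, Op.deqVal, Op.enqVal] using H P' hP'
      · intro H P hP
        simpa [List.filterMap_cons, Op.deqVal, Op.enqVal] using H (.enq v :: P) (List.cons_prefix_cons.2 ⟨rfl, hP⟩)
    | deq v =>
      rw [QueueRun]
      constructor
      · rintro ⟨q', rfl, hq⟩ P hP
        rcases List.prefix_cons_iff.1 hP with rfl | ⟨P', rfl, hP'⟩
        · simp
        · simpa [List.filterMap_cons, Op.deqVal, Op.enqVal] using (ih q').1 hq P' hP'
      · intro H
        have h1 := H [.deq v] (by simp)
        have : ∃ q', q = v :: q' := by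
          obtain ⟨q', hq'⟩ := h1
          exact ⟨q', by simpa [List.filterMap_cons, Op.deqVal, Op.enqVal] using hq'.symm⟩
        obtain ⟨q', rfl⟩ := this
        refine ⟨q', rfl, (ih q').2 fun P hP => ?_⟩
        simpa [List.filterMap_cons, Op.deqVal, Op.enqVal] using H (.deq v :: P) (List.cons_prefix_cons.2 ⟨rfl, hP⟩)

/-- A sorted list whose members form an initial segment of another sorted list is a prefix. -/
theorem prefix_of_pairwise {α : Type*} {R : α → α → Prop} (asymm : ∀ x y, R x y → ¬ R y x)
    {l₁ l₂ : List α} (h₁ : l₁.Pairwise R) (h₂ : l₂.Pairwise R) (hsub : ∀ x ∈ l₁, x ∈ l₂)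
    (hdown : ∀ x ∈ l₁, ∀ y ∈ l₂, R y x → y ∈ l₁) : l₁ <+: l₂ := by
  induction l₁ generalizing l₂ with
  | nil => exact List.nil_prefix
  | cons x l₁ ih =>
    cases l₂ with
    | nil => simpa using hsub x (by simp)
    | cons y l₂ =>
      rw [List.pairwise_cons] at h₁ h₂
      have hxy : x = y := by
        by_contra hne
        have hx : x ∈ l₂ := by simpa [hne] using hsub x (by simp)
        have hyx := h₂.1 x hx
        have hy : y ∈ l₁ := by simpa [Ne.symm hne] using hdown x (by simp) y (by simp) hyx
        exact asymm _ _ hyx (h₁.1 y hy)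
      subst hxy
      refine List.cons_prefix_cons.2 ⟨rfl, ih h₁.2 h₂.2 (fun z hz => ?_) fun z hz w hw hwz => ?_⟩
      · rcases List.mem_cons.1 (hsub z (by simp [hz])) with rfl | h
        · exact absurd (h₁.1 _ hz) fun h => asymm _ _ h h
        · exact h
      · rcases List.mem_cons.1 (hdown z (by simp [hz]) w (by simp [hw]) hwz) with rfl | h
        · exact absurd (h₂.1 _ hw) fun h => asymm _ _ h h
        · exact h

/-! ## Linearizations from linearization points -/

theorem IsEnq.unique {τ : Trace T V} {t : T} {v v' : V} {i i' p p' q q' r r' : ℕ}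
    (h : IsEnq τ t v i p q r) (h' : IsEnq τ t v' i' p' q' r') :
    v = v' ∧ i = i' ∧ p = p' ∧ q = q' ∧ r = r' := by
  have a1 := h.steps _ _ h'.reserve
  have a2 := h.steps _ _ h'.write
  have a3 := h.steps _ _ h'.ret
  have := h.lt_write; have := h.lt_ret; have := h'.lt_write; have := h'.lt_ret
  have b1 := h.reserve; have b2 := h'.reserve
  obtain rfl : p = p' := by omega
  exact ⟨by grind, by grind, rfl, by omega, by omega⟩

theorem IsDeq.unique {τ : Trace T V} {t : T} {v v' : V} {j j' q q' r r' : ℕ}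
    (h : IsDeq τ t v j q r) (h' : IsDeq τ t v' j' q' r') : v = v' ∧ j = j' ∧ q = q' := by
  have a2 := h.steps _ _ h'.swap
  have b1 := h.swap; have b2 := h'.swap; have b3 := h.ret
  obtain rfl : q = q' := by grind [Label.IsSearch]
  exact ⟨by grind, by grind, rfl⟩

theorem IsEnq.not_isDeq {τ : Trace T V} {t : T} {v v' : V} {i p q r j q' r' : ℕ}
    (h : IsEnq τ t v i p q r) : ¬ IsDeq τ t v' j q' r' := by
  intro h'
  have a1 := h.steps _ _ h'.swap
  have b1 := h.reserve; have b2 := h.write; have b3 := h.ret; have b4 := h'.swap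
  grind

theorem TraceFacts.slot_unique {τ : Trace T V} (F : TraceFacts τ) {t t' : T} {v v' : V}
    {i p p' q q' r r' : ℕ} (h : IsEnq τ t v i p q r) (h' : IsEnq τ t' v' i p' q' r') :
    t = t' ∧ v = v' ∧ q = q' := by
  have hp : p = p' := by
    rcases lt_trichotomy p p' with hp | hp | hp
    · exact absurd (F.slot_mono h h' hp) (lt_irrefl _)
    · exact hp
    · exact absurd (F.slot_mono h' h hp) (lt_irrefl _)
  subst hp
  have b1 := h.reserve; have b2 := h'.reserve
  obtain rfl : t = t' := by grind
  have := h.unique h'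
  exact ⟨rfl, this.1, this.2.2.2.1⟩

/-- By `queueRun_iff_prefix`, the values dequeued in each initial segment of `L` must form a prefix
of those enqueued there. Both lists are images of lists of slots, sorted by the keys of the
enqueues; `hbefore` gives inclusion and `hfifo` gives closure downwards, so `prefix_of_pairwise`
applies. -/
theorem TraceFacts.legal {K : Type*} [LinearOrder K] {τ : Trace T V} (F : TraceFacts τ)
    {key : T → K}
    (hbefore : ∀ {e d v v' i p q r q' r'}, IsEnq τ e v i p q r → IsDeq τ d v' i q' r' →
      key e < key d)
    (hfifo : ∀ {e e' d v v' w i i' p q r p' q' r' m n}, IsEnq τ e v i p q r →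
      IsEnq τ e' v' i' p' q' r' → IsDeq τ d w i m n → key e' < key e →
      ∃ d' w' m' n', IsDeq τ d' w' i' m' n' ∧ key d' < key d)
    {L : List T} (hmem : ∀ t ∈ L, ∃ k a, τ[(k : ℕ)]? = some (t, a))
    (hall : ∀ (k : ℕ) t a, τ[k]? = some (t, a) → t ∈ L)
    (hsorted : L.Pairwise (fun t u => key t < key u)) :
    ∃ ops : List (Op V), List.Forall₂ (OpOf τ) L ops ∧ ops ∈ queueSpec V := by
  -- Threads without steps get an arbitrary operation below, which requires a value; without values
  -- there are no steps at all.
  rcases isEmpty_or_nonempty V with hV | hV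
  · have : L = [] := by
      refine List.eq_nil_iff_forall_not_mem.2 fun t ht => ?_
      obtain ⟨k, a, hk⟩ := hmem t ht
      rcases F.complete _ _ _ hk with ⟨v, -⟩ | ⟨v, -⟩ <;> exact hV.elim v
    subst this
    exact ⟨[], .nil, trivial⟩
  have hop : ∀ t, ∃ o : Op V, (∀ {v i p q r}, IsEnq τ t v i p q r → o = .enq v) ∧
      ∀ {v j q r}, IsDeq τ t v j q r → o = .deq v := by
    intro t
    by_cases he : ∃ v i p q r, IsEnq τ t v i p q r
    · obtain ⟨v, i, p, q, r, he⟩ := he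
      exact ⟨.enq v, fun h => by rw [(he.unique h).1], fun h => absurd h he.not_isDeq⟩
    · by_cases hd : ∃ v j q r, IsDeq τ t v j q r
      · obtain ⟨v, j, q, r, hd⟩ := hd
        exact ⟨.deq v, fun h => absurd hd h.not_isDeq, fun h => by rw [(hd.unique h).1]⟩
      · exact ⟨.enq hV.some, fun h => absurd ⟨_, _, _, _, _, h⟩ he,
          fun h => absurd ⟨_, _, _, _, h⟩ hd⟩
  have hslotE : ∀ t, ∃ o : Option ℕ, ∀ i, o = some i ↔ ∃ v p q r, IsEnq τ t v i p q r := by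
    intro t
    by_cases he : ∃ v i p q r, IsEnq τ t v i p q r
    · obtain ⟨v, i, p, q, r, he⟩ := he
      refine ⟨some i, fun i' => ⟨?_, ?_⟩⟩
      · rintro ⟨⟩
        exact ⟨_, _, _, _, he⟩
      · rintro ⟨_, _, _, _, h⟩
        rw [(he.unique h).2.1]
    · refine ⟨none, fun i' => ⟨by simp, ?_⟩⟩
      rintro ⟨_, _, _, _, h⟩
      exact absurd ⟨_, _, _, _, _, h⟩ he
  have hslotD : ∀ t, ∃ o : Option ℕ, ∀ i, o = some i ↔ ∃ v q r, IsDeq τ t v i q r := by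
    intro t
    by_cases he : ∃ v i q r, IsDeq τ t v i q r
    · obtain ⟨v, i, q, r, he⟩ := he
      refine ⟨some i, fun i' => ⟨?_, ?_⟩⟩
      · rintro ⟨⟩
        exact ⟨_, _, _, he⟩
      · rintro ⟨_, _, _, h⟩
        rw [(he.unique h).2.1]
    · refine ⟨none, fun i' => ⟨by simp, ?_⟩⟩
      rintro ⟨_, _, _, h⟩
      exact absurd ⟨_, _, _, _, h⟩ he
  have hval : ∀ i, ∃ v : V, ∀ {t v' p q r}, IsEnq τ t v' i p q r → v' = v := by
    intro i
    by_cases he : ∃ t v p q r, IsEnq τ t v i p q r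
    · obtain ⟨t, v, p, q, r, he⟩ := he
      exact ⟨v, fun h => (F.slot_unique h he).2.1⟩
    · exact ⟨hV.some, fun h => absurd ⟨_, _, _, _, _, h⟩ he⟩
  choose op hopE hopD using hop
  choose slotE hslotE using hslotE
  choose slotD hslotD using hslotD
  choose val hval using hval
  refine ⟨L.map op, ?_, ?_⟩
  · rw [List.forall₂_map_right_iff, List.forall₂_same]
    intro t ht
    obtain ⟨k, a, hk⟩ := hmem t ht
    rcases F.complete _ _ _ hk with ⟨v, i, p, q, r, h⟩ | ⟨v, i, q, r, h⟩
    · rw [hopE t h]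
      exact ⟨i, List.mem_of_getElem? h.reserve⟩
    · rw [hopD t h]
      exact List.mem_of_getElem? h.ret
  change QueueRun [] _
  rw [queueRun_iff_prefix]
  intro P hP
  obtain ⟨n, rfl⟩ : ∃ n, P = (L.take n).map op :=
    ⟨P.length, by rw [List.prefix_iff_eq_take.1 hP, List.map_take]; simp⟩
  have hmemP : ∀ t ∈ L.take n, t ∈ L := fun t ht => List.mem_of_mem_take ht
  have hEv : ((L.take n).map op).filterMap Op.enqVal =
      ((L.take n).filterMap slotE).map val := by
    rw [List.filterMap_map, List.map_filterMap]
    refine List.filterMap_congr fun t ht => ?_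
    obtain ⟨k, a, hk⟩ := hmem t (hmemP t ht)
    rcases F.complete _ _ _ hk with ⟨v, i, p, q, r, h⟩ | ⟨v, i, q, r, h⟩
    · rw [Function.comp, hopE t h, (hslotE t i).2 ⟨_, _, _, _, h⟩]
      simp [Op.enqVal, hval i h]
    · have : slotE t = none := by
        refine Option.eq_none_iff_forall_ne_some.2 fun i hi => ?_
        obtain ⟨_, _, _, _, h'⟩ := (hslotE t i).1 hi
        exact h'.not_isDeq h
      rw [Function.comp, hopD t h, this]
      rfl
  have hDv : ((L.take n).map op).filterMap Op.deqVal =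
      ((L.take n).filterMap slotD).map val := by
    rw [List.filterMap_map, List.map_filterMap]
    refine List.filterMap_congr fun t ht => ?_
    obtain ⟨k, a, hk⟩ := hmem t (hmemP t ht)
    rcases F.complete _ _ _ hk with ⟨v, i, p, q, r, h⟩ | ⟨v, i, q, r, h⟩
    · have : slotD t = none := by
        refine Option.eq_none_iff_forall_ne_some.2 fun i hi => ?_
        obtain ⟨_, _, _, h'⟩ := (hslotD t i).1 hi
        exact h.not_isDeq h'
      rw [Function.comp, hopE t h, this]
      rfl
    · rw [Function.comp, hopD t h, (hslotD t i).2 ⟨_, _, _, h⟩]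
      obtain ⟨_, _, _, _, h', -⟩ := F.enq_of_deq h
      simp [Op.deqVal, hval i h']
  rw [hEv, hDv, List.nil_append]
  refine List.IsPrefix.map _ ?_
  have hsP : (L.take n).Pairwise (fun t u => key t < key u) :=
    hsorted.sublist (List.take_sublist n L)
  have hlower : ∀ u ∈ L.take n, ∀ t ∈ L, key t < key u → t ∈ L.take n := by
    intro u hu t ht htu
    rw [← List.take_append_drop n L, List.mem_append] at ht
    rcases ht with ht | ht
    · exact ht
    · rw [← List.take_append_drop n L, List.pairwise_append] at hsorted
      exact absurd (hsorted.2.2 u hu t ht) htu.asymm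
  have memE : ∀ i, i ∈ (L.take n).filterMap slotE ↔
      ∃ e ∈ L.take n, ∃ v p q r, IsEnq τ e v i p q r := by
    intro i
    simp [List.mem_filterMap, hslotE]
  have memD : ∀ i, i ∈ (L.take n).filterMap slotD ↔
      ∃ d ∈ L.take n, ∃ v q r, IsDeq τ d v i q r := by
    intro i
    simp [List.mem_filterMap, hslotD]
  -- Slots are compared by the keys of the enqueues that reserved them.
  refine prefix_of_pairwise (R := fun i i' => ∃ e e' v v' p p' q q' r r',
    IsEnq τ e v i p q r ∧ IsEnq τ e' v' i' p' q' r' ∧ key e < key e') ?_ ?_ ?_ ?_ ?_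
  · rintro i i' ⟨e, e', _, _, _, _, _, _, _, _, h1, h2, h3⟩
      ⟨f, f', _, _, _, _, _, _, _, _, g1, g2, g3⟩
    obtain rfl := (F.slot_unique h1 g2).1
    obtain rfl := (F.slot_unique h2 g1).1
    exact h3.asymm g3
  · rw [List.pairwise_filterMap]
    refine hsP.imp fun {d d'} hlt i hi i' hi' => ?_
    obtain ⟨w, m, x, hd⟩ := (hslotD d i).1 hi
    obtain ⟨w', m', x', hd'⟩ := (hslotD d' i').1 hi'
    obtain ⟨e, p, q, r, he, -⟩ := F.enq_of_deq hd
    obtain ⟨e', p', q', r', he', -⟩ := F.enq_of_deq hd'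
    refine ⟨e, e', _, _, _, _, _, _, _, _, he, he', ?_⟩
    by_contra hc
    rcases (not_lt.1 hc).lt_or_eq with hlt' | heq
    · obtain ⟨d'', _, _, _, hd'', hk⟩ := hfifo he he' hd hlt'
      obtain rfl := F.deq_unique hd'' hd'
      exact hlt.asymm hk
    · have hee : e' = e ∨ key e' < key e ∨ key e < key e' := by
        by_cases h : e' = e
        · exact .inl h
        · have h1 := hall _ _ _ he.reserve
          have h2 := hall _ _ _ he'.reserve
          obtain ⟨a, ha, rfl⟩ := List.getElem_of_mem h1
          obtain ⟨b, hb, rfl⟩ := List.getElem_of_mem h2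
          rw [List.pairwise_iff_getElem] at hsorted
          rcases lt_trichotomy a b with hab | hab | hab
          · exact .inr (.inr (hsorted a b ha hb hab))
          · subst hab; exact absurd rfl h
          · exact .inr (.inl (hsorted b a hb ha hab))
      rcases hee with rfl | h | h
      · obtain ⟨-, rfl, -⟩ := he.unique he'
        obtain rfl := F.deq_unique hd hd'
        exact lt_irrefl _ hlt
      · exact h.ne heq
      · exact h.ne heq.symm
  · rw [List.pairwise_filterMap]
    refine hsP.imp fun {d d'} hlt i hi i' hi' => ?_
    obtain ⟨w, p, q, r, he⟩ := (hslotE d i).1 hi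
    obtain ⟨w', p', q', r', he'⟩ := (hslotE d' i').1 hi'
    exact ⟨d, d', _, _, _, _, _, _, _, _, he, he', hlt⟩
  · intro i hi
    obtain ⟨d, hd, w, m, x, hD⟩ := (memD i).1 hi
    obtain ⟨e, p, q, r, he, -⟩ := F.enq_of_deq hD
    exact (memE i).2 ⟨e, hlower d hd e (hall _ _ _ he.reserve) (hbefore he hD), _, _, _, _, he⟩
  · rintro i hi i' - ⟨e', e, _, _, _, _, _, _, _, _, he', he, hlt⟩
    obtain ⟨d, hd, w, m, x, hD⟩ := (memD i).1 hi
    obtain ⟨d', w', m', x', hD', hk⟩ := hfifo he he' hD hlt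
    exact (memD i').2 ⟨d', hlower d hd d' (hall _ _ _ hD'.swap) hk, _, _, _, hD'⟩

/-- Sorting the threads by `key` gives the list. The key refines `lp`, so that threads linearized at
the same position can still be ordered. -/
theorem TraceFacts.exists_linearization {K : Type*} [LinearOrder K] {τ : Trace T V}
    (F : TraceFacts τ) {key : T → K} {lp : T → ℕ}
    (hinj : ∀ {k k' t u a b}, τ[(k : ℕ)]? = some (t, a) → τ[(k' : ℕ)]? = some (u, b) →
      key t = key u → t = u)
    (hmono : ∀ {t u}, key t ≤ key u → lp t ≤ lp u)
    (henq : ∀ {e v i p q r}, IsEnq τ e v i p q r → p ≤ lp e ∧ lp e < r)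
    (hdeq : ∀ {d v j q r}, IsDeq τ d v j q r → lp d = q)
    (hbefore : ∀ {e d v v' i p q r q' r'}, IsEnq τ e v i p q r → IsDeq τ d v' i q' r' →
      key e < key d)
    (hfifo : ∀ {e e' d v v' w i i' p q r p' q' r' m n}, IsEnq τ e v i p q r →
      IsEnq τ e' v' i' p' q' r' → IsDeq τ d w i m n → key e' < key e →
      ∃ d' w' m' n', IsDeq τ d' w' i' m' n' ∧ key d' < key d) :
    ∃ L, IsLinearization τ lp L := by
  classical
  have hL : ∃ L : List T, L.Nodup ∧ (∀ t, t ∈ L ↔ ∃ a, (t, a) ∈ τ) ∧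
      L.Pairwise (fun t u => key t ≤ key u) := by
    let r : T → T → Prop := fun t u => key t ≤ key u
    have : Std.Total r := ⟨fun t u => le_total (key t) (key u)⟩
    have : IsTrans T r := ⟨fun _ _ _ h h' => le_trans h h'⟩
    refine ⟨((τ.map Prod.fst).dedup).insertionSort r, ?_, fun t => ?_,
      List.pairwise_insertionSort r _⟩
    · exact (List.perm_insertionSort r _).nodup_iff.2 (List.nodup_dedup _)
    · rw [(List.perm_insertionSort r _).mem_iff, List.mem_dedup]
      simp
  obtain ⟨L, hnd, hmem, hs⟩ := hL
  have hmem1 : ∀ t ∈ L, ∃ k a, τ[(k : ℕ)]? = some (t, a) := by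
    intro t ht
    obtain ⟨a, ha⟩ := (hmem t).1 ht
    obtain ⟨k, hk⟩ := List.mem_iff_getElem?.1 ha
    exact ⟨k, a, hk⟩
  have hmem2 : ∀ (k : ℕ) t a, τ[k]? = some (t, a) → t ∈ L :=
    fun k t a h => (hmem t).2 ⟨a, List.mem_of_getElem? h⟩
  have hs' : L.Pairwise (fun t u => key t < key u) := by
    refine (hs.and hnd).imp_of_mem fun {t u} ht hu h => h.1.lt_of_ne fun heq => h.2 ?_
    obtain ⟨k, a, hk⟩ := hmem1 t ht
    obtain ⟨k', a', hk'⟩ := hmem1 u hu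
    exact hinj hk hk' heq
  refine ⟨L, hnd, hmem, hs.imp hmono, fun t ht => ?_, fun t ht => ?_,
    F.legal hbefore hfifo hmem1 hmem2 hs'⟩
  all_goals
    obtain ⟨k, a, hk⟩ := hmem1 t ht
    rcases F.complete _ _ _ hk with ⟨v, i, p, q, r, h⟩ | ⟨v, i, q, r, h⟩
  · exact ⟨p, _, (henq h).1, h.reserve⟩
  · exact ⟨q, _, (hdeq h).ge, h.swap⟩
  · exact ⟨r, _, (henq h).2, h.ret, trivial⟩
  · exact ⟨r, _, (hdeq h).trans_lt h.lt_ret, h.ret, trivial⟩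

theorem TraceFacts.write_lt_swap {τ : Trace T V} (F : TraceFacts τ) {e d : T} {v v' : V}
    {i p q r q' r' : ℕ} (he : IsEnq τ e v i p q r) (hd : IsDeq τ d v' i q' r') : q < q' := by
  obtain ⟨_, _, _, _, he', hlt⟩ := F.enq_of_deq hd
  rwa [(F.slot_unique he he').2.2]

/-! ### Linearizability of arbitrary traces -/

/-- Enqueues can be ranked by the moment at which their values are removed, those whose values stay
in the queue coming last in the order of their slots. -/
theorem TraceFacts.exists_rank {τ : Trace T V} (F : TraceFacts τ) :
    ∃ rank : T → ℕ, ∀ t v i p q r, IsEnq τ t v i p q r →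
      (∀ d w m x, IsDeq τ d w i m x → rank t = m) ∧
      ((¬ ∃ d w m x, IsDeq τ d w i m x) → rank t = τ.length + i) := by
  suffices h : ∀ t, ∃ n : ℕ, ∀ v i p q r, IsEnq τ t v i p q r →
      (∀ d w m x, IsDeq τ d w i m x → n = m) ∧
      ((¬ ∃ d w m x, IsDeq τ d w i m x) → n = τ.length + i) by
    choose rank hrank using h
    exact ⟨rank, hrank⟩
  intro t
  by_cases he : ∃ v i p q r, IsEnq τ t v i p q r
  · obtain ⟨v, i, p, q, r, he⟩ := he
    by_cases hd : ∃ d w m x, IsDeq τ d w i m x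
    · obtain ⟨d, w, m, x, hd⟩ := hd
      refine ⟨m, fun v' i' p' q' r' he' => ?_⟩
      obtain ⟨-, rfl, -⟩ := he.unique he'
      refine ⟨fun d' w' m' x' hd' => ?_, fun h => absurd ⟨_, _, _, _, hd⟩ h⟩
      obtain rfl := F.deq_unique hd hd'
      exact (hd.unique hd').2.2
    · refine ⟨τ.length + i, fun v' i' p' q' r' he' => ?_⟩
      obtain ⟨-, rfl, -⟩ := he.unique he'
      exact ⟨fun d' w' m' x' hd' => absurd ⟨_, _, _, _, hd'⟩ hd, fun _ => rfl⟩
  · exact ⟨0, fun v i p q r h => absurd ⟨_, _, _, _, _, h⟩ he⟩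

theorem TraceFacts.linearizable {τ : Trace T V} (F : TraceFacts τ) : Linearizable τ := by
  classical
  obtain ⟨rank, hrank⟩ := F.exists_rank
  have rank_deq : ∀ {t v i p q r d w m x}, IsEnq τ t v i p q r → IsDeq τ d w i m x →
      rank t = m := fun he hd => (hrank _ _ _ _ _ _ he).1 _ _ _ _ hd
  have rank_lt : ∀ {t v i p q r}, IsEnq τ t v i p q r → rank t < τ.length →
      ∃ d w x, IsDeq τ d w i (rank t) x := by
    intro t v i p q r he hlt
    by_cases hd : ∃ d w m x, IsDeq τ d w i m x
    · obtain ⟨d, w, m, x, hd⟩ := hd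
      exact ⟨d, w, x, rank_deq he hd ▸ hd⟩
    · have := (hrank _ _ _ _ _ _ he).2 hd
      omega
  have rank_inj : ∀ {t v i p q r t' v' i' p' q' r'}, IsEnq τ t v i p q r →
      IsEnq τ t' v' i' p' q' r' → rank t = rank t' → t = t' := by
    intro t v i p q r t' v' i' p' q' r' he he' heq
    by_cases hlt : rank t < τ.length
    · obtain ⟨d, w, x, hd⟩ := rank_lt he hlt
      obtain ⟨d', w', x', hd'⟩ := rank_lt he' (heq ▸ hlt)
      have h1 := hd.swap; have h2 := hd'.swap
      rw [← heq] at h2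
      obtain rfl : i = i' := by grind
      exact (F.slot_unique he he').1
    · have hn : ∀ {t v i p q r}, IsEnq τ t v i p q r → ¬ rank t < τ.length →
          rank t = τ.length + i := by
        intro t v i p q r he hlt
        refine (hrank _ _ _ _ _ _ he).2 ?_
        rintro ⟨d, w, m, x, hd⟩
        exact hlt (rank_deq he hd ▸ lt_length_of_getElem? hd.swap)
      obtain rfl : i = i' := by
        have := hn he hlt
        have := hn he' (heq ▸ hlt)
        omega
      exact (F.slot_unique he he').1
  -- The earlier call has the smaller slot. A dequeue that empties the larger slot scanned the
  -- smaller one after it was written and found null, so it had been emptied; and values that stay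
  -- are ranked by slot.
  have precedence : ∀ {t v i p q r t' v' i' p' q' r'}, IsEnq τ t v i p q r →
      IsEnq τ t' v' i' p' q' r' → r ≤ p' → rank t < rank t' := by
    intro t v i p q r t' v' i' p' q' r' he he' hrp
    have hpp : p < p' := by have := he.lt_write; have := he.lt_ret; omega
    have hi := F.slot_mono he he' hpp
    by_cases hlt : rank t' < τ.length
    · obtain ⟨d, w, x, hd⟩ := rank_lt he' hlt
      obtain ⟨k, hk1, hk2, hk⟩ := F.scan hd he' i hi
      obtain ⟨d', w', m', x', hd', hm⟩ :=
        F.swap_none hk he (by have := he.lt_ret; omega)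
      rw [rank_deq he hd']
      omega
    · have h1 : rank t' = τ.length + i' := by
        refine (hrank _ _ _ _ _ _ he').2 ?_
        rintro ⟨d, w, m, x, hd⟩
        exact hlt (rank_deq he' hd ▸ lt_length_of_getElem? hd.swap)
      by_cases hlt' : rank t < τ.length
      · omega
      · have : rank t = τ.length + i := by
          refine (hrank _ _ _ _ _ _ he).2 ?_
          rintro ⟨d, w, m, x, hd⟩
          exact hlt' (rank_deq he hd ▸ lt_length_of_getElem? hd.swap)
        omega
  have hlp : ∀ t, ∃ n : ℕ, (∀ {v j q r}, IsDeq τ t v j q r → n = q) ∧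
      ∀ {v i p q r}, IsEnq τ t v i p q r →
        (∃ e v' i' q' r', IsEnq τ e v' i' n q' r' ∧ rank e ≤ rank t) ∧
        ∀ {e v' i' p' q' r'}, IsEnq τ e v' i' p' q' r' → rank e ≤ rank t → p' ≤ n := by
    intro t
    by_cases hd : ∃ v j q r, IsDeq τ t v j q r
    · obtain ⟨v, j, q, r, hd⟩ := hd
      exact ⟨q, fun h => (hd.unique h).2.2, fun h => absurd hd h.not_isDeq⟩
    -- The point of an enqueue is the latest start among the enqueues of no larger rank. It is
    -- monotone in the rank, and by `precedence` it comes before the return of the call.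
    · let Q : ℕ → Prop := fun n => ∃ e v' i' q' r', IsEnq τ e v' i' n q' r' ∧ rank e ≤ rank t
      refine ⟨Nat.findGreatest Q τ.length, fun h => absurd ⟨_, _, _, _, h⟩ hd, fun h => ⟨?_, ?_⟩⟩
      · exact Nat.findGreatest_spec (P := Q) (lt_length_of_getElem? h.reserve).le
          ⟨t, _, _, _, _, h, le_rfl⟩
      · exact fun h' hr => Nat.le_findGreatest (P := Q) (lt_length_of_getElem? h'.reserve).le
          ⟨_, _, _, _, _, h', hr⟩
  choose lp lp_deq lp_enq using hlp
  have lp_mono : ∀ {e v i p q r e' v' i' p' q' r'}, IsEnq τ e v i p q r →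
      IsEnq τ e' v' i' p' q' r' → rank e ≤ rank e' → lp e ≤ lp e' := by
    intro e v i p q r e' v' i' p' q' r' he he' hle
    obtain ⟨f, _, _, _, _, hf, hfr⟩ := (lp_enq e he).1
    exact (lp_enq e' he').2 hf (hfr.trans hle)
  -- One position carries a reservation, the other a swap.
  have lp_ne : ∀ {e v i p q r d v' j q' r'}, IsEnq τ e v i p q r → IsDeq τ d v' j q' r' →
      lp e ≠ lp d := by
    intro e v i p q r d v' j q' r' he hd heq
    obtain ⟨f, _, _, _, _, hf, hfr⟩ := (lp_enq e he).1
    have h1 := hf.reserve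
    rw [heq, lp_deq d hd, hd.swap] at h1
    cases h1
  have rank_le : ∀ {e v i p q r e' v' i' p' q' r'}, IsEnq τ e v i p q r →
      IsEnq τ e' v' i' p' q' r' → toLex (lp e, rank e) < toLex (lp e', rank e') →
      rank e ≤ rank e' := by
    intro e v i p q r e' v' i' p' q' r' he he' hlt
    by_contra hc
    have := lp_mono he' he (not_le.1 hc).le
    rw [Prod.Lex.toLex_lt_toLex] at hlt
    simp only at hlt
    omega
  refine ⟨lp, F.exists_linearization (key := fun t => toLex (lp t, rank t))
    ?_ ?_ ?_ (fun h => lp_deq _ h) ?_ ?_⟩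
  · intro k k' t u a b ht hu heq
    have heq : lp t = lp u ∧ rank t = rank u := by simpa using heq
    rcases F.complete _ _ _ ht with ⟨v, i, p, q, r, h⟩ | ⟨v, i, q, r, h⟩ <;>
    rcases F.complete _ _ _ hu with ⟨v', i', p', q', r', h'⟩ | ⟨v', i', q', r', h'⟩
    · exact rank_inj h h' heq.2
    · exact absurd heq.1 (lp_ne h h')
    · exact absurd heq.1.symm (lp_ne h' h)
    · have h1 := h.swap; have h2 := h'.swap
      rw [← lp_deq t h, heq.1, lp_deq u h'] at h1
      grind
  · intro t u h
    rw [Prod.Lex.toLex_le_toLex] at h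
    simp only at h
    omega
  · intro e v i p q r he
    refine ⟨(lp_enq e he).2 he le_rfl, ?_⟩
    obtain ⟨f, _, _, _, _, hf, hfr⟩ := (lp_enq e he).1
    by_contra hc
    have := precedence he hf (not_lt.1 hc)
    omega
  · intro e d v v' i p q r q' r' he hd
    rw [Prod.Lex.toLex_lt_toLex]
    refine .inl ?_
    -- The point of `e` is the start of some `f` whose value is removed no later than that of `e`;
    -- and `f` starts before its write, which precedes this removal.
    obtain ⟨f, _, i', q₁, _, hf, hfr⟩ := (lp_enq e he).1
    have hre := rank_deq he hd
    have hq' := lt_length_of_getElem? hd.swap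
    obtain ⟨d', w, x, hd'⟩ := rank_lt hf (by omega)
    have := F.write_lt_swap hf hd'
    have := hf.lt_write
    have := lp_deq d hd
    simp only
    omega
  · intro e e' d v v' w i i' p q r p' q' r' m n he he' hd hlt
    have hle := rank_le he' he hlt
    have hre := rank_deq he hd
    have hm := lt_length_of_getElem? hd.swap
    obtain ⟨d', w', x, hd'⟩ := rank_lt he' (by omega)
    refine ⟨d', w', _, x, hd', ?_⟩
    rw [Prod.Lex.toLex_lt_toLex]
    refine .inl ?_
    simp only
    rw [lp_deq d hd, lp_deq d' hd', ← hre]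
    refine hle.lt_of_ne fun heq => ?_
    obtain rfl := rank_inj he' he heq
    exact lt_irrefl _ hlt

/-! ## Traces of the quotient expression -/

/-- A swap that finds a value in slot `j` immediately follows swaps by the same thread that find
`null` in the slots below `j`. -/
def SwapsContiguous (w : Trace T V) : Prop :=
  ∀ (r : ℕ) u j x, w[r]? = some (u, .deqSwap j (some x)) →
    ∃ s, r = s + j ∧ ∀ i < j, w[s + i]? = some (u, .deqSwap i none)

theorem SwapsContiguous.append {w w' : Trace T V} (h : SwapsContiguous w)
    (h' : SwapsContiguous w') : SwapsContiguous (w ++ w') := by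
  intro r u j x hr
  by_cases hlt : r < w.length
  · rw [List.getElem?_append_left hlt] at hr
    obtain ⟨s, rfl, hs⟩ := h r u j x hr
    refine ⟨s, rfl, fun i hi => ?_⟩
    rw [List.getElem?_append_left (by omega)]
    exact hs i hi
  · rw [List.getElem?_append_right (by omega)] at hr
    obtain ⟨s, hrs, hs⟩ := h' _ u j x hr
    refine ⟨w.length + s, by omega, fun i hi => ?_⟩
    rw [List.getElem?_append_right (by omega)]
    convert hs i hi using 2
    omega

theorem SwapsContiguous.flatten {l : List (Trace T V)} (h : ∀ w ∈ l, SwapsContiguous w) :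
    SwapsContiguous l.flatten := by
  induction l with
  | nil => intro r u j x hr; simp at hr
  | cons w l ih =>
    rw [List.flatten_cons]
    exact (h w (by simp)).append (ih fun w hw => h w (by simp [hw]))

theorem SwapsContiguous.of_forall_ne {w : Trace T V}
    (h : ∀ u j x, (u, Label.deqSwap j (some x)) ∉ w) : SwapsContiguous w :=
  fun _ u j x hr => absurd (List.mem_of_getElem? hr) (h u j x)

theorem swapsContiguous_of_mem_deqT {t : T} {w : Trace T V} (hw : w ∈ deqT t) :
    SwapsContiguous w := by
  obtain ⟨r, k, v, rfl⟩ := hw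
  intro m u j x hm
  have hlen : (nullSwaps t k : Trace T V).length = k := by simp [nullSwaps]
  have hget : ∀ i < k, (nullSwaps t k : Trace T V)[i]? = some (t, .deqSwap i none) := by
    intro i hi
    simp [nullSwaps, hi]
  rw [List.cons_append] at hm
  cases m with
  | zero => simp at hm
  | succ m =>
    rw [List.getElem?_cons_succ] at hm
    rcases lt_trichotomy m k with hmk | hmk | hmk
    · rw [List.getElem?_append_left (by omega), hget m hmk] at hm
      simp at hm
    · subst hmk
      rw [List.getElem?_append_right (by omega)] at hm
      simp only [hlen, Nat.sub_self, List.getElem?_cons_zero, Option.some.injEq, Prod.mk.injEq,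
        Label.deqSwap.injEq] at hm
      obtain ⟨rfl, rfl, -⟩ := hm
      -- Position 0 of the iteration is the range read.
      refine ⟨1, by omega, fun i hi => ?_⟩
      rw [List.cons_append, add_comm, List.getElem?_cons_succ,
        List.getElem?_append_left (by omega), hget i hi]
    · rw [List.getElem?_append_right (by omega)] at hm
      obtain ⟨n, hn⟩ : ∃ n, m - (nullSwaps t k : Trace T V).length = n + 1 := ⟨m - k - 1, by omega⟩
      rw [hn, List.getElem?_cons_succ] at hm
      cases n <;> simp at hm

/-- This is all that is used of the quotient expression: successful swaps occur only in `deqT`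
words, which are uninterrupted. -/
theorem swapsContiguous_of_mem_quotientExpr [LinearOrder T] {τ : Trace T V}
    (hτ : τ ∈ quotientExpr T V) : SwapsContiguous τ := by
  obtain ⟨l, rfl, hl⟩ := Language.mem_kstar.1 hτ
  refine SwapsContiguous.flatten fun w hw => ?_
  obtain ⟨w₁, ⟨w₂, ⟨w₃, h₃, w₄, h₄, rfl⟩, w₅, h₅, rfl⟩, w₆, h₆, rfl⟩ := hl w hw
  refine ((SwapsContiguous.append ?_ ?_).append ?_).append ?_
  · obtain ⟨l, -, hl, rfl⟩ := h₃
    refine SwapsContiguous.flatten fun x hx => ?_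
    obtain ⟨y, hy, rfl⟩ := List.mem_map.1 hx
    obtain ⟨r, k, h⟩ := hl y hy
    rw [h]
    exact .of_forall_ne (by simp [nullSwaps])
  · obtain ⟨l, -, -, hl, rfl⟩ := h₄
    refine SwapsContiguous.flatten fun x hx => ?_
    obtain ⟨y, hy, rfl⟩ := List.mem_map.1 hx
    obtain ⟨v, i, h⟩ := hl y hy
    rw [h]
    exact .of_forall_ne (by simp)
  · obtain ⟨l, -, hl, rfl⟩ := h₅
    refine SwapsContiguous.flatten fun x hx => ?_
    obtain ⟨y, hy, rfl⟩ := List.mem_map.1 hx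
    obtain ⟨t, v, h⟩ := hl y hy
    rw [h]
    exact .of_forall_ne (by simp)
  · obtain ⟨l, -, hl, rfl⟩ := h₆
    refine SwapsContiguous.flatten fun x hx => ?_
    obtain ⟨y, hy, rfl⟩ := List.mem_map.1 hx
    exact swapsContiguous_of_mem_deqT (hl y hy)

theorem TraceFacts.exists_fixedPoints {τ : Trace T V} (F : TraceFacts τ)
    (hc : SwapsContiguous τ) (ho : WritesOrdered τ) :
    ∃ (lp : T → ℕ) (L : List T), IsFixedPoints τ lp ∧ IsLinearization τ lp L := by
  have hlp : ∀ t, ∃ n : ℕ, (∀ {v i p q r}, IsEnq τ t v i p q r → n = q) ∧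
      ∀ {v j q r}, IsDeq τ t v j q r → n = q := by
    intro t
    by_cases he : ∃ v i p q r, IsEnq τ t v i p q r
    · obtain ⟨v, i, p, q, r, he⟩ := he
      exact ⟨q, fun h => (he.unique h).2.2.2.1, fun h => absurd h he.not_isDeq⟩
    · by_cases hd : ∃ v j q r, IsDeq τ t v j q r
      · obtain ⟨v, j, q, r, hd⟩ := hd
        exact ⟨q, fun h => absurd hd h.not_isDeq, fun h => (hd.unique h).2.2⟩
      · exact ⟨0, fun h => absurd ⟨_, _, _, _, _, h⟩ he, fun h => absurd ⟨_, _, _, _, h⟩ hd⟩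
  choose lp lp_enq lp_deq using hlp
  have lp_step : ∀ {k t a}, τ[(k : ℕ)]? = some (t, a) →
      (∃ i v, τ[lp t]? = some (t, Label.enqW i v)) ∨
      (∃ j v, τ[lp t]? = some (t, Label.deqSwap j (some v))) := by
    intro k t a hk
    rcases F.complete _ _ _ hk with ⟨v, i, p, q, r, h⟩ | ⟨v, i, q, r, h⟩
    · exact .inl ⟨i, v, by rw [lp_enq t h, h.write]⟩
    · exact .inr ⟨i, v, by rw [lp_deq t h, h.swap]⟩
  obtain ⟨L, hL⟩ : ∃ L, IsLinearization τ lp L := by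
    refine F.exists_linearization (key := lp) ?_ id ?_ (fun h => lp_deq _ h) ?_ ?_
    · intro k k' t u a b ht hu heq
      have h1 := lp_step ht
      have h2 := lp_step hu
      rw [heq] at h1
      grind
    · intro e v i p q r he
      rw [lp_enq e he]
      exact ⟨he.lt_write.le, he.lt_ret⟩
    · intro e d v v' i p q r q' r' he hd
      rw [lp_enq e he, lp_deq d hd]
      exact F.write_lt_swap he hd
    · intro e e' d v v' w i i' p q r p' q' r' m n he he' hd hlt
      rw [lp_enq e he, lp_enq e' he'] at hlt
      have hqm := F.write_lt_swap he hd
      suffices ∃ d' w' m' n', IsDeq τ d' w' i' m' n' ∧ m' < m by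
        obtain ⟨d', w', m', n', hd', hm⟩ := this
        exact ⟨d', w', m', n', hd', by rwa [lp_deq d hd, lp_deq d' hd']⟩
      rcases lt_trichotomy i i' with hi | rfl | hi
      -- The larger slot `i'` was written first, so `WritesOrdered` provides its removal before `m`.
      · obtain ⟨k, u, y, -, hk2, hk3⟩ := ho q' q m _ _ _ i' i i _ _ _ hlt hqm hi he'.write
          he.write hd.swap
        rcases F.complete _ _ _ hk3 with ⟨_, _, _, _, _, h⟩ | ⟨_, j, k', _, h⟩
        · have := h.steps _ _ hk3
          have h1 := h.reserve; have h2 := h.write; have h3 := h.ret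
          grind
        · have := h.steps _ _ hk3
          have h1 := h.swap; have h2 := h.ret
          obtain rfl : k = k' := by grind [Label.IsSearch]
          obtain rfl : j = i' := by grind
          exact ⟨_, _, _, _, h, hk2⟩
      · obtain ⟨rfl, -⟩ := F.slot_unique he he'
        exact absurd (he.unique he').2.2.2.1 (by omega)
      · obtain ⟨s, rfl, hs⟩ := hc _ _ _ _ hd.swap
        -- The positions from `s` up to the successful swap hold only swaps of `d`, so the write to
        -- `i'` precedes the whole scan, which then finds null in `i'`.
        have hq's : q' < s := by
          by_contra hge
          have h1 := hs (q' - s) (by omega)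
          rw [Nat.add_sub_cancel' (by omega), he'.write] at h1
          cases h1
        obtain ⟨d', w', m', n', hd', hm⟩ := F.swap_none (hs i' hi) he' (by omega)
        exact ⟨d', w', m', n', hd', by omega⟩
  refine ⟨lp, L, fun t ⟨a, ha⟩ => ?_, hL⟩
  obtain ⟨k, hk⟩ := List.mem_iff_getElem?.1 ha
  exact lp_step hk

/-! ## Dependence on the future -/

/-- If `x` is dequeued, and `y` is enqueued before every `enq(x)`, then `y` is dequeued earlier. -/
theorem deq_mem_of_queueRun {h₁ h₂ : List (Op V)} {x y : V} {A B : List V}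
    (h : QueueRun [] (h₁ ++ .deq x :: h₂))
    (hE : (h₁ ++ .deq x :: h₂).filterMap Op.enqVal = A ++ y :: B) (hA : x ∉ A) (hxy : x ≠ y) :
    .deq y ∈ h₁ := by
  have hP : h₁ ++ [.deq x] <+: h₁ ++ .deq x :: h₂ := ⟨h₂, by simp⟩
  have h1 := (queueRun_iff_prefix _ _).1 h _ hP
  rw [List.nil_append] at h1
  have h2 := h1.trans (hP.filterMap Op.enqVal)
  rw [hE, List.filterMap_append] at h2
  change h₁.filterMap Op.deqVal ++ [x] <+: _ at h2
  have h3 : A ++ [y] <+: A ++ y :: B := ⟨B, by simp⟩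
  -- If at most `A.length` values had been dequeued before `x`, then `x` would be among `A ++ [y]`.
  have h4 : A ++ [y] <+: h₁.filterMap Op.deqVal := by
    rcases Nat.lt_or_ge (h₁.filterMap Op.deqVal).length (A ++ [y]).length with hlt | hge
    · have h5 := List.prefix_of_prefix_length_le h2 h3 (by simpa using hlt)
      have hx : x ∈ A ++ [y] := h5.subset (by simp)
      simp [hA, hxy] at hx
    · exact List.prefix_of_prefix_length_le h3 ((List.prefix_append _ _).trans h2) hge
  have hy : y ∈ h₁.filterMap Op.deqVal := h4.subset (by simp)
  obtain ⟨o, ho, hoy⟩ := List.mem_filterMap.1 hy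
  cases o with
  | enq v => simp [Op.deqVal] at hoy
  | deq v => simp [Op.deqVal] at hoy; exact hoy ▸ ho

theorem TraceFacts.opOf_unique {τ : Trace T V} (F : TraceFacts τ) {t : T} {o o' : Op V}
    (h : OpOf τ t o) (h' : OpOf τ t o') : o = o' := by
  have key : ∀ {o : Op V}, OpOf τ t o → (∃ v i p q r, o = .enq v ∧ IsEnq τ t v i p q r) ∨
      ∃ v j q r, o = .deq v ∧ IsDeq τ t v j q r := by
    intro o ho
    cases o with
    | enq v =>
      obtain ⟨i, hi⟩ := ho
      obtain ⟨k, hk⟩ := List.mem_iff_getElem?.1 hi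
      rcases F.complete _ _ _ hk with ⟨v', i', p, q, r, h⟩ | ⟨v', j, q, r, h⟩
      · have := h.steps _ _ hk
        have h1 := h.reserve; have h2 := h.write; have h3 := h.ret
        obtain rfl : v = v' := by grind
        exact .inl ⟨_, _, _, _, _, rfl, h⟩
      · have := h.steps _ _ hk
        have h1 := h.swap; have h2 := h.ret
        grind [Label.IsSearch]
    | deq v =>
      obtain ⟨k, hk⟩ := List.mem_iff_getElem?.1 ho
      rcases F.complete _ _ _ hk with ⟨v', i', p, q, r, h⟩ | ⟨v', j, q, r, h⟩
      · have := h.steps _ _ hk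
        have h1 := h.reserve; have h2 := h.write; have h3 := h.ret
        grind
      · have := h.steps _ _ hk
        have h1 := h.swap; have h2 := h.ret
        obtain rfl : v = v' := by grind [Label.IsSearch]
        exact .inr ⟨_, _, _, _, rfl, h⟩
  rcases key h with ⟨_, _, _, _, _, rfl, hE⟩ | ⟨_, _, _, _, rfl, hE⟩ <;>
  rcases key h' with ⟨_, _, _, _, _, rfl, hE'⟩ | ⟨_, _, _, _, rfl, hE'⟩
  · rw [(hE.unique hE').1]
  · exact absurd hE' hE.not_isDeq
  · exact absurd hE hE'.not_isDeq
  · rw [(hE.unique hE').1]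

/-- Transfers `deq_mem_of_queueRun` from operations to threads. The enqueue of `x` must be unique:
another one before `t` would let `x` be dequeued first. -/
theorem IsLinearization.exists_deq_precedes {τ : Trace T V} {lp : T → ℕ} {L : List T}
    (hL : IsLinearization τ lp L) (F : TraceFacts τ) {t u d : T} {x y : V} (hxy : x ≠ y)
    (ht : OpOf τ t (.enq y)) (hu : ∀ t', OpOf τ t' (.enq x) → t' = u) (htu : Precedes L t u)
    (hd : OpOf τ d (.deq x)) : ∃ d', OpOf τ d' (.deq y) ∧ Precedes L d' d := by
  obtain ⟨ops, hops, hleg⟩ := hL.legal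
  obtain ⟨hlen, hget⟩ := List.forall₂_iff_get.1 hops
  have hop : ∀ (n : ℕ) s, L[n]? = some s → ∀ o, OpOf τ s o → ops[n]? = some o := by
    intro n s hn o ho
    obtain ⟨hn', rfl⟩ := List.getElem?_eq_some_iff.1 hn
    rw [List.getElem?_eq_getElem (by omega)]
    exact congrArg some (F.opOf_unique (hget n hn' (by omega)) ho)
  have hop' : ∀ (n : ℕ) o, ops[n]? = some o → ∃ s, L[n]? = some s ∧ OpOf τ s o := by
    intro n o hn
    obtain ⟨hn', rfl⟩ := List.getElem?_eq_some_iff.1 hn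
    exact ⟨L[n], List.getElem?_eq_getElem (by omega), hget n (by omega) hn'⟩
  obtain ⟨k, m, hkm, hk, hm⟩ := htu
  have hdL : d ∈ L := (hL.mem_iff d).2 ⟨_, hd⟩
  obtain ⟨n, hn⟩ := List.mem_iff_getElem?.1 hdL
  obtain ⟨hn', hnd⟩ := List.getElem?_eq_some_iff.1 (hop n d hn _ hd)
  obtain ⟨hk', hkt⟩ := List.getElem?_eq_some_iff.1 (hop k t hk _ ht)
  have hsplit : ops = ops.take n ++ .deq x :: ops.drop (n + 1) := by
    rw [← hnd, List.cons_getElem_drop_succ, List.take_append_drop]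
  have hsplit' : ops = ops.take k ++ .enq y :: ops.drop (k + 1) := by
    rw [← hkt, List.cons_getElem_drop_succ, List.take_append_drop]
  have hE : ops.filterMap Op.enqVal = (ops.take k).filterMap Op.enqVal ++
      y :: (ops.drop (k + 1)).filterMap Op.enqVal := by
    conv_lhs => rw [hsplit']
    rw [List.filterMap_append]
    rfl
  have hA : x ∉ (ops.take k).filterMap Op.enqVal := by
    intro hx
    obtain ⟨o, ho, hox⟩ := List.mem_filterMap.1 hx
    obtain rfl : o = .enq x := by
      cases o with
      | enq v => simp [Op.enqVal] at hox; rw [hox]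
      | deq v => simp [Op.enqVal] at hox
    obtain ⟨i, hi⟩ := List.mem_iff_getElem?.1 ho
    rw [List.getElem?_take] at hi
    split_ifs at hi with hik
    obtain ⟨s, hs, hso⟩ := hop' i _ hi
    obtain rfl := hu s hso
    have := List.Nodup.getElem_inj_iff hL.nodup (i := i) (j := m)
      (hi := (List.getElem?_eq_some_iff.1 hs).1) (hj := (List.getElem?_eq_some_iff.1 hm).1)
    rw [(List.getElem?_eq_some_iff.1 hs).2, (List.getElem?_eq_some_iff.1 hm).2] at this
    have := this.1 rfl
    omega
  have hmem : .deq y ∈ ops.take n := by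
    refine deq_mem_of_queueRun (x := x) (h₂ := ops.drop (n + 1))
      (B := (ops.drop (k + 1)).filterMap Op.enqVal) ?_ ?_ hA hxy
    · rw [← hsplit]; exact hleg
    · rw [← hsplit]; exact hE
  obtain ⟨i, hi⟩ := List.mem_iff_getElem?.1 hmem
  rw [List.getElem?_take] at hi
  split_ifs at hi with hin
  obtain ⟨s, hs, hso⟩ := hop' i _ hi
  exact ⟨s, hso, i, n, hin, hs, hn⟩

theorem precedes_or_precedes {L : List T} {t u : T} (ht : t ∈ L) (hu : u ∈ L) (hne : t ≠ u) :
    Precedes L t u ∨ Precedes L u t := by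
  obtain ⟨k, hk⟩ := List.mem_iff_getElem?.1 ht
  obtain ⟨m, hm⟩ := List.mem_iff_getElem?.1 hu
  rcases lt_trichotomy k m with h | rfl | h
  · exact .inl ⟨k, m, h, hk, hm⟩
  · exact absurd (Option.some.inj (hk.symm.trans hm)) hne
  · exact .inr ⟨m, k, h, hm, hk⟩

theorem IsLinearization.lp_le_of_precedes {τ : Trace T V} {lp : T → ℕ} {L : List T}
    (hL : IsLinearization τ lp L) {t u : T} (h : Precedes L t u) : lp t ≤ lp u := by
  obtain ⟨k, m, hkm, hk, hm⟩ := h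
  obtain ⟨hk', rfl⟩ := List.getElem?_eq_some_iff.1 hk
  obtain ⟨hm', rfl⟩ := List.getElem?_eq_some_iff.1 hm
  exact List.pairwise_iff_getElem.1 hL.sorted k m hk' hm' hkm

/-- Linearizations respect the real-time order. -/
theorem IsLinearization.lp_lt_of_append {τ₁ τ₂ : Trace T V} {lp : T → ℕ} {L : List T}
    (hL : IsLinearization (τ₁ ++ τ₂) lp L) {t u : T} (ht : t ∈ L) (hu : u ∈ L)
    (ht' : ∀ a, (t, a) ∉ τ₂) (hu' : ∀ a, (u, a) ∉ τ₁) : lp t < lp u := by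
  obtain ⟨k, a, hk, hka, -⟩ := hL.before_return t ht
  obtain ⟨m, b, hm, hmb⟩ := hL.after_start u hu
  have h1 : k < τ₁.length := by
    by_contra hc
    rw [List.getElem?_append_right (by omega)] at hka
    exact ht' a (List.mem_of_getElem? hka)
  have h2 : τ₁.length ≤ m := by
    by_contra hc
    rw [List.getElem?_append_left (by omega)] at hmb
    exact hu' b (List.mem_of_getElem? hmb)
  omega

/-! ### The branching executions -/

/-- Two enqueues of `a` and `b` complete while a dequeue is past the slot of `a`; two more
enqueues have reserved slots. -/
def branchPrefix (e : ℕ → T) (a b c : V) : Trace T V :=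
  [(e 1, .enqI a 0), (e 2, .enqI b 1), (e 3, .enqI c 2), (e 4, .enqI c 3),
   (e 5, .deqRead 3), (e 5, .deqSwap 0 none),
   (e 1, .enqW 0 a), (e 1, .enqRet), (e 2, .enqW 1 b), (e 2, .enqRet)]

/-- A dequeue finds `a`. -/
def branchDeqFst (e : ℕ → T) (a : V) : Trace T V :=
  [(e 6, .deqRead 3), (e 6, .deqSwap 0 (some a)), (e 6, .deqRet a)]

/-- A later dequeue finds `b`, and the one in progress finds `c`. -/
def branchDeqSnd (e : ℕ → T) (b c : V) : Trace T V :=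
  [(e 7, .deqRead 3), (e 7, .deqSwap 0 none), (e 7, .deqSwap 1 (some b)), (e 7, .deqRet b),
   (e 3, .enqW 2 c), (e 3, .enqRet), (e 4, .enqW 3 c), (e 4, .enqRet),
   (e 5, .deqSwap 1 none), (e 5, .deqSwap 2 (some c)), (e 5, .deqRet c)]

/-- The dequeue in progress finds `b`. -/
def branchDeqPending (e : ℕ → T) (b c : V) : Trace T V :=
  [(e 5, .deqSwap 1 (some b)), (e 5, .deqRet b),
   (e 3, .enqW 2 c), (e 3, .enqRet), (e 4, .enqW 3 c), (e 4, .enqRet)]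

/-- The calls in the two branches. -/
def branchEnv [DecidableEq T] (e : ℕ → T) (a b c : V) : Env T V := fun t =>
  if t = e 1 then some (.enq a) else if t = e 2 then some (.enq b) else
  if t = e 3 then some (.enq c) else if t = e 4 then some (.enq c) else
  if t = e 5 then some .deq else if t = e 6 then some .deq else
  if t = e 7 then some .deq else none

theorem branchEnv_finite [DecidableEq T] (e : ℕ → T) (a b c : V) :
    {t | branchEnv e a b c t ≠ none}.Finite := by
  refine (Set.toFinite {e 1, e 2, e 3, e 4, e 5, e 6, e 7}).subset fun t ht => ?_
  by_contra hc
  simp only [Set.mem_insert_iff, Set.mem_singleton_iff, not_or] at hc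
  exact ht (by simp [branchEnv, hc])

theorem LoopGuard.holds_of_lt (g : LoopGuard) {j r : ℕ} (h : j < r) : g.Holds j r := by
  cases g
  · exact h
  · exact h.le

/-- The trace `τ` is possible with shared state `(back, items)` and local states `loc`, and it
completes all calls that have started. -/
def Completes [DecidableEq T] (g : LoopGuard) (env : Env T V) (back : ℕ) (items : ℕ → Option V)
    (loc : T → Option (LocalState V)) (τ : Trace T V) : Prop :=
  ∃ c', Exec g env ⟨⟨back, items⟩, loc⟩ τ c' ∧ c'.Final

namespace Completes

variable [DecidableEq T] {g : LoopGuard} {env : Env T V} {n : ℕ} {f : ℕ → Option V}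
  {loc : T → Option (LocalState V)} {t : T} {v : V} {i j r : ℕ} {τ : Trace T V}

theorem cons {a : Label V} {l l' : LocalState V} {s' : Shared V}
    (hl : (loc t).or ((env t).map Call.entry) = some l) (hs : ThreadStep g l ⟨n, f⟩ a l' s')
    (h : Completes g env s'.back s'.items (Function.update loc t (some l')) τ) :
    Completes g env n f loc ((t, a) :: τ) :=
  h.imp fun _ h => ⟨.cons hl hs h.1, h.2⟩

theorem enqI (hl : (loc t).or ((env t).map Call.entry) = some (.enqStart v))
    (h : Completes g env (n + 1) f (Function.update loc t (some (.enqReserved v n))) τ) :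
    Completes g env n f loc ((t, .enqI v n) :: τ) :=
  cons hl (.enqI _ _) h

theorem enqW_enqRet (hl : loc t = some (.enqReserved v i))
    (h : Completes g env n (Function.update f i (some v))
      (Function.update loc t (some .finished)) τ) :
    Completes g env n f loc ((t, .enqW i v) :: (t, .enqRet) :: τ) :=
  cons (by rw [hl]; rfl) (.enqW _ _ _) (cons (by simp) (.enqRet _) (by simpa using h))

theorem deqRead (hl : (loc t).or ((env t).map Call.entry) = some .deqHead) (hr : r < n)
    (h : Completes g env n f (Function.update loc t (some (.deqScan r 0))) τ) :
    Completes g env n f loc ((t, .deqRead r) :: τ) :=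
  cons hl (.deqRead _ _ hr) h

theorem deqSwap_none (hl : loc t = some (.deqScan r j)) (hj : j < r) (hf : f j = none)
    (h : Completes g env n f (Function.update loc t (some (.deqScan r (j + 1)))) τ) :
    Completes g env n f loc ((t, .deqSwap j none) :: τ) :=
  cons (by rw [hl]; rfl) (.deqSwapNull _ _ _ (g.holds_of_lt hj) hf)
    (by rw [← hf]; simpa using h)

theorem deqSwap_deqRet (hl : loc t = some (.deqScan r j)) (hj : j < r) (hf : f j = some v)
    (h : Completes g env n (Function.update f j none)
      (Function.update loc t (some .finished)) τ) :
    Completes g env n f loc ((t, .deqSwap j (some v)) :: (t, .deqRet v) :: τ) :=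
  cons (by rw [hl]; rfl) (.deqSwapVal _ _ _ _ (g.holds_of_lt hj) hf)
    (cons (by simp) (.deqRet _ _) (by simpa using h))

end Completes

/-- The last slot swapped is 2. Range 3 makes it reachable even under the strict guard, and choosing
range 3 requires four reservations; this is why a fourth enqueue takes part. -/
theorem branches_mem_traces [DecidableEq T] (g : LoopGuard) {e : ℕ → T}
    (he : Function.Injective e) (a b c : V) :
    branchPrefix e a b c ++ (branchDeqFst e a ++ branchDeqSnd e b c) ∈ traces T V g ∧
    branchPrefix e a b c ++ branchDeqPending e b c ∈ traces T V g := by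
  constructor <;>
  · refine ⟨branchEnv e a b c, branchEnv_finite e a b c, ?_⟩
    simp only [branchPrefix, branchDeqFst, branchDeqSnd, branchDeqPending, List.cons_append,
      List.nil_append]
    change Completes g _ 0 (fun _ => none) (fun _ => none) _
    repeat
      first
      | refine Completes.enqI (by simp [branchEnv, he.eq_iff, Call.entry]) ?_
      | refine Completes.enqW_enqRet (by simp [he.eq_iff]) ?_
      | refine Completes.deqRead (by simp [branchEnv, he.eq_iff, Call.entry]) (by decide) ?_
      | refine Completes.deqSwap_none (r := 3) (by simp [he.eq_iff])
          (by decide) (by simp) ?_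
      | refine Completes.deqSwap_deqRet (r := 3) (by simp [he.eq_iff])
          (by decide) (by simp) ?_
    refine ⟨_, .nil _, fun t l => ?_⟩
    simp only [Function.update_apply]
    grind

/-- Whether the enqueue by `e 1` or that by `e 2` comes first is decided after both returned. -/
theorem exists_future_dependent [DecidableEq T] [Infinite T] (g : LoopGuard) {a b c : V}
    (hab : a ≠ b) (hac : a ≠ c) (hbc : b ≠ c) :
    ∃ (π σ₁ σ₂ : Trace T V) (t₁ t₂ : T),
      π ++ σ₁ ∈ traces T V g ∧ π ++ σ₂ ∈ traces T V g ∧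
      (t₁, Label.enqRet) ∈ π ∧ (t₂, Label.enqRet) ∈ π ∧
      (∀ (lp : T → ℕ) (L : List T), IsLinearization (π ++ σ₁) lp L → Precedes L t₁ t₂) ∧
      (∀ (lp : T → ℕ) (L : List T), IsLinearization (π ++ σ₂) lp L → Precedes L t₂ t₁) := by
  let e : ℕ → T := Infinite.natEmbedding T
  have he : Function.Injective e := (Infinite.natEmbedding T).injective
  clear_value e
  obtain ⟨h₁, h₂⟩ := branches_mem_traces g he a b c
  have F₁ := traceFacts_of_mem_traces h₁
  have F₂ := traceFacts_of_mem_traces h₂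
  refine ⟨_, _, _, e 1, e 2, h₁, h₂, by simp [branchPrefix], by simp [branchPrefix], ?_, ?_⟩
  · intro lp L hL
    have mem : ∀ t, (∃ a, (t, a) ∈ _) → t ∈ L := fun t => (hL.mem_iff t).2
    refine (precedes_or_precedes (mem (e 1) ⟨.enqI a 0, by simp [branchPrefix]⟩)
      (mem (e 2) ⟨.enqI b 1, by simp [branchPrefix]⟩) (he.ne (by decide))).resolve_right fun hp => ?_
    -- If `b` were enqueued first, its dequeue by `e 7` would precede that of `a` by `e 6`; but `e
    -- 7` starts only after `e 6` has returned.
    obtain ⟨d, hd, hdp⟩ := hL.exists_deq_precedes F₁ (d := e 6) hab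
      ⟨1, by simp [branchPrefix]⟩
      (by simp [OpOf, branchPrefix, branchDeqFst, branchDeqSnd, hab, hac]) hp
      (by simp [OpOf, branchDeqFst])
    obtain rfl : d = e 7 := by
      simpa [OpOf, branchPrefix, branchDeqFst, branchDeqSnd, hab.symm, hbc] using hd
    have h6 := mem (e 6) ⟨.deqRet a, by simp [branchDeqFst]⟩
    have h7 := mem (e 7) ⟨_, hd⟩
    have hle := hL.lp_le_of_precedes hdp
    rw [← List.append_assoc] at hL
    have hlt := hL.lp_lt_of_append h6 h7 (by simp [branchDeqSnd, he.eq_iff])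
      (by simp [branchPrefix, branchDeqFst, he.eq_iff])
    omega
  · intro lp L hL
    have mem : ∀ t, (∃ a, (t, a) ∈ _) → t ∈ L := fun t => (hL.mem_iff t).2
    refine (precedes_or_precedes (mem (e 2) ⟨.enqI b 1, by simp [branchPrefix]⟩)
      (mem (e 1) ⟨.enqI a 0, by simp [branchPrefix]⟩) (he.ne (by decide))).resolve_right fun hp => ?_
    -- If `a` were enqueued first, it would have to be dequeued before `b`; but it is never dequeued
    -- in this branch.
    obtain ⟨d, hd, -⟩ := hL.exists_deq_precedes F₂ (d := e 5) hab.symm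
      ⟨0, by simp [branchPrefix]⟩
      (by simp [OpOf, branchPrefix, branchDeqPending, hab.symm, hbc]) hp
      (by simp [OpOf, branchDeqPending])
    simp [OpOf, branchPrefix, branchDeqPending, hab] at hd

end HerlihyWing

theorem mainTheorem12 (T V : Type*) [LinearOrder T] [Infinite T] (g : HerlihyWing.LoopGuard) :
    -- the queue is linearizable
    (∀ τ ∈ HerlihyWing.traces T V g, HerlihyWing.Linearizable τ) ∧
    -- fixed linearization points on the traces of the quotient expression
    (∀ τ ∈ HerlihyWing.traces T V g,
      τ ∈ HerlihyWing.quotientExpr T V → HerlihyWing.WritesOrdered τ →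
        ∃ (lp : T → ℕ) (L : List T),
          HerlihyWing.IsFixedPoints τ lp ∧ HerlihyWing.IsLinearization τ lp L) ∧
    -- on arbitrary traces the linearization order of two completed enqueues depends on the future
    (∀ a b c : V, a ≠ b → a ≠ c → b ≠ c →
      ∃ (π σ₁ σ₂ : HerlihyWing.Trace T V) (t₁ t₂ : T),
        π ++ σ₁ ∈ HerlihyWing.traces T V g ∧ π ++ σ₂ ∈ HerlihyWing.traces T V g ∧
        (t₁, HerlihyWing.Label.enqRet) ∈ π ∧ (t₂, HerlihyWing.Label.enqRet) ∈ π ∧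
        (∀ (lp : T → ℕ) (L : List T), HerlihyWing.IsLinearization (π ++ σ₁) lp L →
          HerlihyWing.Precedes L t₁ t₂) ∧
        (∀ (lp : T → ℕ) (L : List T), HerlihyWing.IsLinearization (π ++ σ₂) lp L →
          HerlihyWing.Precedes L t₂ t₁)) :=
  ⟨fun _ hτ => (HerlihyWing.traceFacts_of_mem_traces hτ).linearizable,
    fun _ hτ hq ho => (HerlihyWing.traceFacts_of_mem_traces hτ).exists_fixedPoints
      (HerlihyWing.swapsContiguous_of_mem_quotientExpr hq) ho,
    fun _ _ _ hab hac hbc => HerlihyWing.exists_future_dependent g hab hac hbc⟩
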